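/- **Setting.** Let $d\ge 1$, $\mathcal X=\mathbb R^d$, and for $k\ge 0$ let $\mathcal T_k=\biguplus_{0\le\beta\le\varepsilon\le k}\{\beta\}\times\{\varepsilon\}\times\mathcal X^{\varepsilon-\beta+1}$ be the space of trajectories $X=(\beta,\varepsilon,x_{\beta:\varepsilon})$ up to time $k$, with reference measure $dX$ the sum of the Lebesgue measures. Densities $f(\mathbf X)$ of random finite subsets $\mathbf X$ of $\mathcal T_k$ are taken with respect to the set integral $\int g(\mathbf X)\,\delta\mathbf X=g(\emptyset)+\sum_{n\ge1}\frac1{n!}\int g(\{X^1,\dots,X^n\})\,dX^1\cdots dX^n$. The Bernoulli density with existence probability $r\in[0,1]$ and single-trajectory probability density $f$ is $1-r$ at $\emptyset$, $rf(X)$ at $\{X\}$, and $0$ at larger sets. **MBM densities.** Let $m_\tau$ be the number of measurements at time $\tau$ and $\mathcal M_{k'}=\{(\tau,j):1\le\tau\le k',\,1\le j\le m_\tau\}$. An MBM at time $k$, given the measurements up to time $k'$, has tracks $i=1,\dots,n$. Track $i$ has $h^i$ hypotheses, and each hypothesis $a^i\in\{1,\dots,h^i\}$ has a measurement history $\mathcal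 M(i,a^i)$ (a finite set of pairs $(\tau,j)$), a weight $w^{i,a^i}\in[0,\infty)$, an existence probability $r^{i,a^i}\in[0,1]$ and a probability density $f^{i,a^i}$ on $\mathcal T_k$. Let $\mathcal A$ be the set of all $a=(a^1,\dots,a^n)$ for which the sets $\mathcal M(i,a^i)$ are pairwise disjoint and contained in $\mathcal M_{k'}$, let $w^a\propto\prod_i w^{i,a^i}$ be normalised so that $\sum_{a\in\mathcal A}w^a=1$ (the sum of the products is assumed to be nonzero), and put $$f(\mathbf X)=\sum_{a\in\mathcal A}w^a\sum_{\mathbf X^1\uplus\dots\uplus\mathbf X^n=\mathbf X}\ \prod_{i=1}^n f^{i,a^i}(\mathbf X^i),$$ where $f^{i,a^i}(\mathbf X^i)$ is the Bernoulli density with parameters $r^{i,a^i}$ and $f^{i,a^i}$. **Transition and birth.** Let $P^S:\mathcal X\to[0,1]$ be a survival probability and $\pi(y|x)$ a transition probability density on $\mathcal X$. From time $k-1\ge 0$ to time $k$, a trajectory $X'=(\beta',\varepsilon',x')$ moves according to the probability kernel $\pi^a(\cdot|X')$: if $\varepsilon'<k-1$, it is kept unchanged; if $\varepsilon'=k-1$,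 it is kept unchanged with probability $1-P^S(x'_{k-1})$, and with probability $P^S(x'_{k-1})$ it becomes $(\beta',k,(x'_{\beta':k-1},y))$ with $y\sim\pi(\cdot|x'_{k-1})$. Newborn trajectories at time $k$ form a multi-Bernoulli random finite set whose components $l=1,\dots,n^b$ have existence probabilities $r^{b,l}$ and densities $f^{B,l}(\beta,\varepsilon,x_{\beta:\varepsilon})=f^{b,l}(x_k)$ if $\beta=\varepsilon=k$ and $0$ otherwise, where $f^{b,l}$ is a probability density on $\mathcal X$. Given the set $\mathbf X'$ at time $k-1$, the set at time $k$ is the union of the set of newborn trajectories and of one trajectory drawn from $\pi^a(\cdot|X')$ for each $X'\in\mathbf X'$, all independent. **Theorem (prediction for the set of all trajectories).** Suppose that the set of trajectories at time $k-1$, given the measurements up to time $k-1$, has an MBM density with $n$ tracks and parameters $h^i$, $\mathcal M(i,a^i)$, $w^{i,a^i}$, $r^{i,a^i}$, $f^{i,a^i}$. Then the predicted law of the set of trajectories at time $k$ has an MBM density, with $n+n^b$ tracks and the following parameters. * For the continuing tracks $i\in\{1,\dots,n\}$, the numbers $h^i$ of hypotheses, the histories, the weights $w^{i,a^i}$ and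 the existence probabilities $r^{i,a^i}$ are unchanged, and the density of hypothesis $a^i$ becomes $\langle f^{i,a^i};\pi^a\rangle$, the density of the measure $\int f^{i,a^i}(X')\,\pi^a(\cdot|X')\,dX'$. With $f=f^{i,a^i}$, it is given by $$\langle f;\pi^a\rangle(\beta,\varepsilon,x_{\beta:\varepsilon})=\begin{cases}f(\beta,\varepsilon,x_{\beta:\varepsilon}),&\varepsilon<k-1,\\ (1-P^S(x_{k-1}))\,f(\beta,k-1,x_{\beta:k-1}),&\varepsilon=k-1,\\ P^S(x_{k-1})\,\pi(x_k|x_{k-1})\,f(\beta,k-1,x_{\beta:k-1}),&\beta<\varepsilon=k,\\ 0,&\beta=\varepsilon=k.\end{cases}$$ * Each new track $i=n+l$, $l\in\{1,\dots,n^b\}$, has one hypothesis, with empty measurement history, weight $1$, existence probability $r^{b,l}$ and density $f^{B,l}$. -/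

import Mathlib

open MeasureTheory
open scoped ENNReal

noncomputable section

namespace TrajMBM

/-! ### Finite sets over a measurable space: reference measure, densities, independent unions -/

section RFS

variable {E : Type*}

/-- The finite subsets of `E`, as the space on which the laws of random finite sets live. (A copy of
`Finset E`, since the existing σ-algebra on `Finset E`, generated by the events `x ∈ X`, is too
coarse for uncountable `E`.) -/
@[ext]
structure FinSet (E : Type*) where
  val : Finset E

open Classical in
/-- The map `(x₁, …, xₙ) ↦ {x₁, …, xₙ}` from vectors to finite sets. -/
def toSet (n : ℕ) (x : Fin n → E) : FinSet E := ⟨Finset.univ.image x⟩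

/-- The σ-algebra on finite sets: `B` is measurable iff, for every `n`, the set of vectors
`(x₁, …, xₙ)` with `{x₁, …, xₙ} ∈ B` is measurable. -/
instance instMeasurableSpaceFinSet [MeasurableSpace E] : MeasurableSpace (FinSet E) :=
  ⨅ n : ℕ, MeasurableSpace.map (toSet (E := E) n) inferInstance

theorem measurable_toSet [MeasurableSpace E] (n : ℕ) : Measurable (toSet (E := E) n) := by
  intro B hB
  exact (MeasurableSpace.measurableSet_iInf.mp hB) n

/-- The reference measure on finite sets associated with a measure `ν` on the single-object space:
`∫ g dμ = g(∅) + ∑ₙ (1/n!) ∫ ⋯ ∫ g({x₁, …, xₙ}) ν(dx₁) ⋯ ν(dxₙ)`, i.e. the set integral. -/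
def setMeasure [MeasurableSpace E] (ν : Measure E) : Measure (FinSet E) :=
  Measure.sum fun n : ℕ =>
    ((n.factorial : ℝ≥0∞)⁻¹) • (Measure.pi fun _ : Fin n => ν).map (toSet n)

/-- Multi-object density of a Bernoulli RFS with existence probability `r` and single-object
density `f`: `1 - r` at `∅`, `r * f x` at `{x}`, and `0` at sets with two or more elements. -/
def bernoulliDensity (r : ℝ≥0∞) (f : E → ℝ≥0∞) (X : Finset E) : ℝ≥0∞ :=
  if X.card = 0 then 1 - r else if X.card = 1 then r * ∑ x ∈ X, f x else 0

theorem bernoulliDensity_empty (r : ℝ≥0∞) (f : E → ℝ≥0∞) :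
    bernoulliDensity r f ∅ = 1 - r := by
  simp [bernoulliDensity]

theorem bernoulliDensity_singleton (r : ℝ≥0∞) (f : E → ℝ≥0∞) (x : E) :
    bernoulliDensity r f {x} = r * f x := by
  simp [bernoulliDensity]

open Classical in
/-- The families `(X¹, …, Xⁿ)` of pairwise disjoint, possibly empty sets whose union is `X`. -/
def decompositions (n : ℕ) (X : Finset E) : Finset (Fin n → Finset E) :=
  (Fintype.piFinset fun _ : Fin n => X.powerset).filter fun Y =>
    Pairwise (fun i j => Disjoint (Y i) (Y j)) ∧ Finset.univ.biUnion Y = X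

open Classical in
/-- The law of the union of finitely many independent random finite sets with laws `P i`. -/
def indepUnion [MeasurableSpace E] {ι : Type*} [Fintype ι] (P : ι → Measure (FinSet E)) :
    Measure (FinSet E) :=
  (Measure.pi P).map fun Y => ⟨Finset.univ.biUnion fun i => (Y i).val⟩

end RFS

/-! ### Trajectories -/

/-- The single-target state space `ℝ^d`. -/
abbrev State (d : ℕ) := EuclideanSpace ℝ (Fin d)

/-- Pairs `(β, ε)` of a start and an end time with `0 ≤ β ≤ ε ≤ k`. -/
abbrev Span (k : ℕ) := {p : ℕ × ℕ // p.1 ≤ p.2 ∧ p.2 ≤ k}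

/-- Trajectories up to time `k`: tuples `(β, ε, x_{β:ε})`, the states being indexed by the times
`β, …, ε`. -/
abbrev Trajectory (d k : ℕ) := Σ p : Span k, (Finset.Icc p.1.1 p.1.2 → State d)

/-- The reference measure `dX` on trajectories: the sum over `(β, ε)` of the Lebesgue measures. -/
def trajMeasure (d k : ℕ) : Measure (Trajectory d k) :=
  Measure.sum fun p : Span k =>
    (volume : Measure (Finset.Icc p.1.1 p.1.2 → State d)).map (Sigma.mk p)

/-- The last state `x_ε`. -/
def Trajectory.last {d k : ℕ} (X : Trajectory d k) : State d :=
  X.2 ⟨X.1.1.2, Finset.mem_Icc.mpr ⟨X.1.2.1, le_rfl⟩⟩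

/-- The same trajectory, seen at time `k + 1`. -/
def Trajectory.keep {d k : ℕ} (X : Trajectory d k) : Trajectory d (k + 1) :=
  ⟨⟨X.1.1, X.1.2.1, X.1.2.2.trans (Nat.le_succ k)⟩, X.2⟩

/-- The trajectory extended by one time step with the state `y` at time `ε + 1`. -/
def Trajectory.extend {d k : ℕ} (X : Trajectory d k) (y : State d) : Trajectory d (k + 1) :=
  ⟨⟨(X.1.1.1, X.1.1.2 + 1), X.1.2.1.trans (Nat.le_succ _), Nat.succ_le_succ X.1.2.2⟩,
    fun κ => if h : κ.1 ≤ X.1.1.2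
      then X.2 ⟨κ.1, Finset.mem_Icc.mpr ⟨(Finset.mem_Icc.mp κ.2).1, h⟩⟩ else y⟩

/-! ### Dynamics and birth -/

/-- Single-target dynamics: the survival probability `P^S(x)` and the Markov transition density
`trans x y = π(y | x)`. -/
structure Dynamics (d : ℕ) where
  survival : State d → ℝ≥0∞
  measurable_survival : Measurable survival
  survival_le_one : ∀ x, survival x ≤ 1
  trans : State d → State d → ℝ≥0∞
  measurable_trans : Measurable (Function.uncurry trans)
  lintegral_trans : ∀ x, ∫⁻ y, trans x y = 1

/-- Multi-Bernoulli birth with `nb` components: existence probabilities and state densities. -/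
structure Birth (d nb : ℕ) where
  r : Fin nb → ℝ≥0∞
  r_le_one : ∀ l, r l ≤ 1
  f : Fin nb → State d → ℝ≥0∞
  measurable_f : ∀ l, Measurable (f l)
  lintegral_f : ∀ l, ∫⁻ x, f l x = 1

/-- The birth density on trajectories: `f^b(x_k)` on trajectories with `β = ε = k`, else `0`. -/
def birthDensity {d : ℕ} (k : ℕ) (f : State d → ℝ≥0∞) (X : Trajectory d k) : ℝ≥0∞ :=
  if X.1.1.1 = k ∧ X.1.1.2 = k then f X.last else 0

/-- The law of the newborn set of the Bernoulli component with parameters `r`, `f` at time `k`. -/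
def birthLaw {d : ℕ} (k : ℕ) (r : ℝ≥0∞) (f : State d → ℝ≥0∞) :
    Measure (FinSet (Trajectory d k)) :=
  (setMeasure (trajMeasure d k)).withDensity fun X =>
    bernoulliDensity r (birthDensity k f) X.val

namespace Dynamics

variable {d : ℕ} (D : Dynamics d)

/-- The survival probability of a trajectory: `P^S(x_ε)` if it is alive at time `k`, else `0`. -/
def trajSurvival {k : ℕ} (X : Trajectory d k) : ℝ≥0∞ :=
  if X.1.1.2 = k then D.survival X.last else 0

/-- The transition `π^a(· | X')` of one trajectory from time `k` to time `k + 1`, in the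
all-trajectories model. It has Dirac parts, so it is a measure: with probability
`1 - P^S_k(X')` (which is `1` if `X'` has ended before time `k`) the trajectory is kept unchanged,
with probability `P^S_k(X')` it is extended by a state drawn from `π(· | x'_ε')`. -/
def trajTransition {k : ℕ} (X' : Trajectory d k) : Measure (Trajectory d (k + 1)) :=
  (1 - D.trajSurvival X') • Measure.dirac X'.keep +
    D.trajSurvival X' • (volume.withDensity (D.trans X'.last)).map X'.extend

/-- The density `⟨f; π^a⟩(X) = ∫ f(X') π^a(X | X') dX'`, the Dirac factors being integrated out.
That it is the density of the measure `∫ f(X') π^a(· | X') dX'` is a claim, not part of the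
definition. -/
def innerTransition {k : ℕ} (f : Trajectory d k → ℝ≥0∞) (X : Trajectory d (k + 1)) : ℝ≥0∞ :=
  if hε : X.1.1.2 ≤ k then
    -- not extended at time `k + 1`
    let X' : Trajectory d k := ⟨⟨X.1.1, X.1.2.1, hε⟩, X.2⟩
    f X' * (1 - D.trajSurvival X')
  else if hβ : X.1.1.1 ≤ k then
    -- `ε = k + 1`, and `X'` is the part of `X` up to time `k`
    let X' : Trajectory d k := ⟨⟨(X.1.1.1, k), hβ, le_rfl⟩, fun κ => X.2 ⟨κ.1, Finset.mem_Icc.mpr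
      ⟨(Finset.mem_Icc.mp κ.2).1, (Finset.mem_Icc.mp κ.2).2.trans (not_le.mp hε).le⟩⟩⟩
    f X' * (D.trajSurvival X' * D.trans X'.last X.last)
  else 0

/-- The set of trajectories at time `k + 1` that results from one trajectory `X'` at time `k`. -/
def persistLaw {k : ℕ} (X' : Trajectory d k) : Measure (FinSet (Trajectory d (k + 1))) :=
  (D.trajTransition X').map fun X => ⟨{X}⟩

/-- The transition model for sets of trajectories: given the set `S'` at time `k`, the set at time
`k + 1` is the union of the Bernoulli components of the birth and of the sets that result from the
elements of `S'`, all independent. -/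
def setTransition {nb : ℕ} (B : Birth d nb) (k : ℕ) (S' : FinSet (Trajectory d k)) :
    Measure (FinSet (Trajectory d (k + 1))) :=
  indepUnion (ι := Fin nb ⊕ {X' // X' ∈ S'.val})
    (Sum.elim (fun l => birthLaw (k + 1) (B.r l) (B.f l)) (fun X' => D.persistLaw X'.1))

end Dynamics

/-! ### Multi-Bernoulli mixtures -/

/-- A track: `h` single-trajectory hypotheses, each with a measurement history `M a` (a set of pairs
of a time step and a measurement index), a weight, an existence probability and a density. -/
structure Track (d k : ℕ) where
  h : ℕ
  M : Fin h → Finset (ℕ × ℕ)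
  w : Fin h → ℝ≥0∞
  r : Fin h → ℝ≥0∞
  f : Fin h → Trajectory d k → ℝ≥0∞

/-- The set of all measurement indices `(τ, j)`, `1 ≤ τ ≤ k'`, `1 ≤ j ≤ m τ`, up to time `k'`. -/
def measurementIndices (m : ℕ → ℕ) (k' : ℕ) : Set (ℕ × ℕ) :=
  {p | 1 ≤ p.1 ∧ p.1 ≤ k' ∧ 1 ≤ p.2 ∧ p.2 ≤ m p.1}

section MBM

variable {d k n : ℕ}

open Classical in
/-- The global hypotheses: one single-trajectory hypothesis for each track, such that all the
measurement histories lie in the set of measurements up to time `k'` and are pairwise disjoint. -/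
def globalHypotheses (m : ℕ → ℕ) (k' : ℕ) (T : Fin n → Track d k) :
    Finset ((i : Fin n) → Fin (T i).h) :=
  Finset.univ.filter fun a =>
    (⋃ i, ((T i).M (a i) : Set (ℕ × ℕ))) ⊆ measurementIndices m k' ∧
      Pairwise fun i j => Disjoint ((T i).M (a i)) ((T j).M (a j))

/-- The sum over all the global hypotheses of the products of their weights. -/
def totalWeight (m : ℕ → ℕ) (k' : ℕ) (T : Fin n → Track d k) : ℝ≥0∞ :=
  ∑ a ∈ globalHypotheses m k' T, ∏ i, (T i).w (a i)

/-- The weight `w^a ∝ ∏ i, w^{i,a^i}` of a global hypothesis, normalised to sum `1`. -/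
def globalWeight (m : ℕ → ℕ) (k' : ℕ) (T : Fin n → Track d k) (a : (i : Fin n) → Fin (T i).h) :
    ℝ≥0∞ :=
  (∏ i, (T i).w (a i)) / totalWeight m k' T

/-- The MBM density
`∑ a, w^a ∑_{X¹ ⊎ ⋯ ⊎ Xⁿ = S} ∏ i, f^{i,a^i}(Xⁱ)`, with Bernoulli densities `f^{i,a^i}`. -/
def mbmDensity (m : ℕ → ℕ) (k' : ℕ) (T : Fin n → Track d k) (S : Finset (Trajectory d k)) : ℝ≥0∞ :=
  ∑ a ∈ globalHypotheses m k' T, globalWeight m k' T a *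
    ∑ Y ∈ decompositions n S, ∏ i, bernoulliDensity ((T i).r (a i)) ((T i).f (a i)) (Y i)

/-- The law on sets of trajectories whose multi-trajectory density is the MBM density. -/
def mbmLaw (m : ℕ → ℕ) (k' : ℕ) (T : Fin n → Track d k) : Measure (FinSet (Trajectory d k)) :=
  (setMeasure (trajMeasure d k)).withDensity fun S => mbmDensity m k' T S.val

/-- The parameters are those of an MBM: finite weights that can be normalised, existence
probabilities at most `1`, and probability densities. -/
structure IsMBM (m : ℕ → ℕ) (k' : ℕ) (T : Fin n → Track d k) : Prop where
  w_ne_top : ∀ i a, (T i).w a ≠ ∞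
  totalWeight_ne_zero : totalWeight m k' T ≠ 0
  r_le_one : ∀ i a, (T i).r a ≤ 1
  measurable_f : ∀ i a, Measurable ((T i).f a)
  lintegral_f : ∀ i a, ∫⁻ X, (T i).f a X ∂(trajMeasure d k) = 1

end MBM

/-- A continuing track: same hypotheses, histories, weights and existence probabilities; the
densities become `⟨f; π^a⟩`. -/
def Track.predict {d k : ℕ} (D : Dynamics d) (T : Track d k) : Track d (k + 1) where
  h := T.h
  M := T.M
  w := T.w
  r := T.r
  f := fun a => D.innerTransition (T.f a)

/-- The new track of a birth component: one hypothesis, with empty history and weight `1`. -/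
def Track.birth {d : ℕ} (k : ℕ) (r : ℝ≥0∞) (f : State d → ℝ≥0∞) : Track d k where
  h := 1
  M := fun _ => ∅
  w := fun _ => 1
  r := fun _ => r
  f := fun _ => birthDensity k f

/-- The predicted track table: `n` continuing tracks followed by `nb` new tracks. -/
def predict {d k n nb : ℕ} (D : Dynamics d) (B : Birth d nb) (T : Fin n → Track d k) :
    Fin (n + nb) → Track d (k + 1) :=
  Fin.append (fun i => (T i).predict D) (fun l => Track.birth (k + 1) (B.r l) (B.f l))

end TrajMBM

end

/-!
The law of the predicted set is computed by viewing every law as a union of independent Bernoulli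
sets.

* *The prior is a mixture of multi-Bernoulli laws.* At a set with `N` distinct elements, the sum
  over its decompositions into `n` Bernoulli components runs over the injective assignments of the
  `N` elements to the components. Integrating, the factor `1 / N!` of the set integral cancels the
  `N!` assignments with the same range `s`, and what remains is the mixture over the sets `s` of
  nonempty components of the laws of `{xᵢ : i ∈ s}` with independent `xᵢ`. This is the law of the
  union of independent Bernoulli sets (`withDensity_sum_decompositions`, `indepUnion_bernoulli`).
  The reference measure must have no atoms, so that the `xᵢ` are almost surely distinct; this is
  where `d ≥ 1` enters.
* *Prediction acts on each component.* Given distinct `xᵢ`, the next set is the union of the births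
  and of one independent singleton for each `xᵢ` (`setTransition_image`). Moving independent points
  independently gives independent points, so the predicted law is multi-Bernoulli, with the same
  existence probabilities (`indepUnion_bernoulli_bind_setTransition`).
* *The single-trajectory density.* The reference measure at time `k + 1` splits into the kept
  trajectories, the extended ones and those born at time `k + 1` (`lintegral_trajMeasure_succ`),
  which identifies the moved law (`Dynamics.withDensity_bind_trajTransition`).
* *The mixture weights.* The new tracks have one hypothesis each, with empty history and weight `1`,
  so the predicted global hypotheses and weights are the prior ones (`exists_equiv_predict`).

The measurability of the union map and of the transition are not formal: the σ-algebra on finite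
sets is a quotient σ-algebra, which is not obviously compatible with products. A Borel injection of
the single-object space into `ℝ` orders the elements of each finite set, and this gives measurable
enumerations (`exists_measurable_enumeration`).
-/

namespace TrajMBM

/-! ### Measurability on the space of finite sets -/

section Measurability

variable {E : Type*} [MeasurableSpace E]

theorem measurable_finSet_iff {β : Type*} [MeasurableSpace β] {F : FinSet E → β} :
    Measurable F ↔ ∀ n, Measurable (F ∘ toSet n) := by
  constructor
  · exact fun h n => h.comp (measurable_toSet n)
  · intro h B hB
    refine MeasurableSpace.measurableSet_iInf.mpr fun n => ?_
    exact h n hB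

theorem exists_measurable_injective_real [MeasurableSpace.CountablySeparated E] :
    ∃ φ : E → ℝ, Measurable φ ∧ Function.Injective φ := by
  obtain ⟨f, hf, hfi⟩ := MeasurableSpace.measurable_injection_nat_bool_of_countablySeparated E
  obtain ⟨g, hg⟩ := exists_measurableEmbedding_real (ℕ → Bool)
  exact ⟨g ∘ f, hg.measurable.comp hf, hg.injective.comp hfi⟩

omit [MeasurableSpace E] in
/-- Every finite family has a subfamily that is strictly increasing for the values of `φ` and takes
the same values of `φ`. -/
theorem exists_strictMono_subfamily {φ : E → ℝ} {N : ℕ}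
    (x : Fin N → E) : ∃ n, ∃ c : Fin n → Fin N, StrictMono (fun j => φ (x (c j))) ∧
      ∀ i, ∃ j, φ (x i) = φ (x (c j)) := by
  classical
  set S : Finset ℝ := Finset.univ.image fun i => φ (x i) with hS
  have hmem : ∀ j, ∃ i, φ (x i) = S.orderEmbOfFin rfl j := fun j => by
    obtain ⟨i, -, hi⟩ := Finset.mem_image.mp (S.orderEmbOfFin_mem rfl j)
    exact ⟨i, hi⟩
  choose c hc using hmem
  refine ⟨S.card, c, ?_, fun i => ?_⟩
  · simp_rw [hc]; exact (S.orderEmbOfFin rfl).strictMono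
  · have : φ (x i) ∈ Set.range (S.orderEmbOfFin rfl) := by
      rw [Finset.range_orderEmbOfFin]; simp [hS]
    obtain ⟨j, hj⟩ := this
    exact ⟨j, by rw [hc, hj]⟩

omit [MeasurableSpace E] in
theorem toSet_comp_eq {φ : E → ℝ} (hφ : Function.Injective φ) {n N : ℕ} {x : Fin N → E}
    {c : Fin n → Fin N} (h : ∀ i, ∃ j, φ (x i) = φ (x (c j))) :
    toSet N x = toSet n (x ∘ c) := by
  classical
  ext a
  simp only [toSet, Finset.mem_image, Finset.mem_univ, true_and, Function.comp]
  constructor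
  · rintro ⟨i, rfl⟩
    obtain ⟨j, hj⟩ := h i
    exact ⟨j, (hφ hj).symm⟩
  · rintro ⟨j, rfl⟩; exact ⟨c j, rfl⟩

/-- To prove that a function of a finite set is measurable, it suffices to look at increasing
enumerations: the vectors with a given pattern of repetitions and a given ordering form a
measurable set, and there are finitely many patterns. -/
theorem measurable_finSet_of_strictMono {β : Type*} [MeasurableSpace β] {F : FinSet E → β}
    {φ : E → ℝ} (hφm : Measurable φ) (hφ : Function.Injective φ)
    (G : ∀ n, (Fin n → E) → β) (hG : ∀ n, Measurable (G n))
    (h : ∀ n x, StrictMono (fun j => φ (x j)) → F (toSet n x) = G n x) : Measurable F := by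
  refine measurable_finSet_iff.mpr fun N B hB => ?_
  let P : (Σ n, Fin n → Fin N) → Set (Fin N → E) := fun c =>
    {x | StrictMono (fun j => φ (x (c.2 j))) ∧ ∀ i, ∃ j, φ (x i) = φ (x (c.2 j))}
  have hP : ∀ c, MeasurableSet (P c) := by
    intro c
    have hm : ∀ i : Fin N, Measurable fun x : Fin N → E => φ (x i) :=
      fun i => hφm.comp (measurable_pi_apply i)
    have e1 : MeasurableSet {x : Fin N → E | StrictMono (fun j => φ (x (c.2 j)))} := by
      have : {x : Fin N → E | StrictMono (fun j => φ (x (c.2 j)))} =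
          ⋂ i, ⋂ j, {x | i < j → φ (x (c.2 i)) < φ (x (c.2 j))} := by
        ext x; simp [StrictMono]
      rw [this]
      refine .iInter fun i => .iInter fun j => ?_
      by_cases hij : i < j
      · simpa [hij] using measurableSet_lt (hm _) (hm _)
      · simp [hij]
    have e2 : MeasurableSet {x : Fin N → E | ∀ i, ∃ j, φ (x i) = φ (x (c.2 j))} := by
      have : {x : Fin N → E | ∀ i, ∃ j, φ (x i) = φ (x (c.2 j))} =
          ⋂ i, ⋃ j, {x | φ (x i) = φ (x (c.2 j))} := by
        ext x; simp
      rw [this]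
      exact .iInter fun i => .iUnion fun j => measurableSet_eq_fun (hm _) (hm _)
    exact e1.inter e2
  have hval : ∀ c, ∀ x ∈ P c, F (toSet N x) = G c.1 (x ∘ c.2) := by
    rintro ⟨n, c⟩ x ⟨hx1, hx2⟩
    rw [toSet_comp_eq hφ hx2]
    exact h n _ hx1
  have : F ∘ toSet N ⁻¹' B = ⋃ c, P c ∩ (fun x => G c.1 (x ∘ c.2)) ⁻¹' B := by
    ext x
    simp only [Set.mem_preimage, Function.comp_apply, Set.mem_iUnion, Set.mem_inter_iff]
    constructor
    · intro hx
      obtain ⟨n, c, hc1, hc2⟩ := exists_strictMono_subfamily (φ := φ) x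
      refine ⟨⟨n, c⟩, ⟨hc1, hc2⟩, ?_⟩
      rwa [← hval ⟨n, c⟩ x ⟨hc1, hc2⟩]
    · rintro ⟨c, hc, hx⟩
      rwa [hval c x hc]
  rw [this]
  refine .iUnion fun c => (hP c).inter ?_
  exact ((hG c.1).comp (measurable_pi_lambda _ fun j => measurable_pi_apply _)) hB

omit [MeasurableSpace E] in
theorem injective_of_strictMono_comp {φ : E → ℝ} {n : ℕ} {x : Fin n → E}
    (h : StrictMono fun j => φ (x j)) : Function.Injective x :=
  Function.Injective.of_comp (f := φ) h.injective

omit [MeasurableSpace E] in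
open Classical in
theorem card_toSet {n : ℕ} {x : Fin n → E} (h : Function.Injective x) :
    (toSet n x).val.card = n := by
  simp [toSet, Finset.card_image_of_injective _ h]

theorem measurable_finSet_of_injective [MeasurableSpace.CountablySeparated E] {β : Type*}
    [MeasurableSpace β] {F : FinSet E → β} (G : ∀ n, (Fin n → E) → β) (hG : ∀ n, Measurable (G n))
    (h : ∀ n x, Function.Injective x → F (toSet n x) = G n x) : Measurable F := by
  obtain ⟨φ, hφm, hφ⟩ := exists_measurable_injective_real (E := E)
  exact measurable_finSet_of_strictMono hφm hφ G hG
    fun n x hx => h n x (injective_of_strictMono_comp hx)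

theorem measurable_card [MeasurableSpace.CountablySeparated E] :
    Measurable fun S : FinSet E => S.val.card :=
  measurable_finSet_of_injective (fun n _ => n) (fun _ => measurable_const)
    fun _ _ h => card_toSet h

/-- A measurable enumeration of the `n`-element sets, i.e. a measurable section of
`(x₁, …, xₙ) ↦ {x₁, …, xₙ}`: sets are listed in increasing order for a Borel linear order. -/
theorem exists_measurable_enumeration [MeasurableSpace.CountablySeparated E] [Nonempty E] (n : ℕ) :
    ∃ s : FinSet E → Fin n → E, Measurable s ∧ ∀ S, S.val.card = n → toSet n (s S) = S := by
  classical
  obtain ⟨φ, hφm, hφ⟩ := exists_measurable_injective_real (E := E)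
  let x₀ : Fin n → E := fun _ => Classical.arbitrary E
  let s : FinSet E → Fin n → E := fun S =>
    if h : ∃ x : Fin n → E, StrictMono (fun j => φ (x j)) ∧ toSet n x = S then h.choose else x₀
  have hs : ∀ x : Fin n → E, StrictMono (fun j => φ (x j)) → s (toSet n x) = x := by
    intro x hx
    have h : ∃ y : Fin n → E, StrictMono (fun j => φ (y j)) ∧ toSet n y = toSet n x := ⟨x, hx, rfl⟩
    have e : s (toSet n x) = h.choose := dif_pos h
    rw [e]
    obtain ⟨h1, h2⟩ := h.choose_spec
    generalize h.choose = y at h1 h2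
    have hr : Set.range y = Set.range x := by
      have := congrArg (fun S : FinSet E => (S.val : Set E)) h2
      simpa [toSet] using this
    have : (fun j => φ (y j)) = fun j => φ (x j) := by
      refine (StrictMono.range_inj h1 hx).mp ?_
      change Set.range (φ ∘ y) = Set.range (φ ∘ x)
      rw [Set.range_comp, Set.range_comp, hr]
    funext j
    exact hφ (congrFun this j)
  refine ⟨s, ?_, ?_⟩
  · refine measurable_finSet_of_strictMono hφm hφ
      (fun N x => if h : N = n then fun j => x (Fin.cast h.symm j) else x₀) ?_ ?_
    · intro N
      by_cases h : N = n
      · simp only [h, dif_pos]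
        exact measurable_pi_lambda _ fun j => measurable_pi_apply _
      · simp only [h]; exact measurable_const
    · intro N x hx
      by_cases h : N = n
      · subst h
        simpa using hs x hx
      · rw [dif_neg h]
        refine dif_neg ?_
        rintro ⟨y, hy, hyx⟩
        apply h
        rw [← card_toSet (injective_of_strictMono_comp hx), ← hyx,
          card_toSet (injective_of_strictMono_comp hy)]
  · intro S hS
    have hSx : toSet S.val.card (fun i => (S.val.equivFin.symm i : E)) = S := by
      ext a
      simp only [toSet, Finset.mem_image, Finset.mem_univ, true_and]
      exact ⟨by rintro ⟨i, rfl⟩; exact (S.val.equivFin.symm i).2,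
        fun ha => ⟨S.val.equivFin ⟨a, ha⟩, by simp⟩⟩
    obtain ⟨m, c, hc1, hc2⟩ := exists_strictMono_subfamily (φ := φ)
      (fun i => (S.val.equivFin.symm i : E))
    have h2 := (toSet_comp_eq hφ hc2).symm.trans hSx
    obtain rfl : m = n := by
      rw [← card_toSet (injective_of_strictMono_comp hc1), ← hS]
      exact congrArg (fun T => T.val.card) h2
    rw [← h2]
    exact congrArg (toSet m) (hs _ hc1)

open Classical in
theorem measurable_image {ι : Type*} [Fintype ι] :
    Measurable fun x : ι → E => (⟨Finset.univ.image x⟩ : FinSet E) := by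
  let e := Fintype.equivFin ι
  have : (fun x : ι → E => (⟨Finset.univ.image x⟩ : FinSet E)) =
      toSet (Fintype.card ι) ∘ fun x j => x (e.symm j) := by
    funext x
    ext a
    simp only [toSet, Function.comp, Finset.mem_image, Finset.mem_univ, true_and]
    exact ⟨fun ⟨i, h⟩ => ⟨e i, by simpa using h⟩, fun ⟨j, h⟩ => ⟨_, h⟩⟩
  rw [this]
  exact (measurable_toSet _).comp (measurable_pi_lambda _ fun j => measurable_pi_apply _)

open Classical in
theorem measurable_image_finset {ι : Type*} (s : Finset ι) :
    Measurable fun x : ι → E => (⟨s.image x⟩ : FinSet E) := by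
  have : (fun x : ι → E => (⟨s.image x⟩ : FinSet E)) =
      (fun x : s → E => (⟨Finset.univ.image x⟩ : FinSet E)) ∘ fun x i => x i := by
    funext x
    ext a
    simp
  rw [this]
  exact measurable_image.comp (measurable_pi_lambda _ fun j => measurable_pi_apply _)

theorem measurable_singleton : Measurable fun x : E => (⟨{x}⟩ : FinSet E) := by
  classical
  have : (fun x : E => (⟨{x}⟩ : FinSet E)) = toSet 1 ∘ fun x _ => x := by
    funext x; ext a; simp [toSet]
  rw [this]
  exact (measurable_toSet 1).comp (measurable_pi_lambda _ fun _ => measurable_id)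

open Classical in
/-- The union of finite sets, as a map on the product space. -/
noncomputable def union {E : Type*} {ι : Type*} [Fintype ι] (Y : ι → FinSet E) : FinSet E :=
  ⟨Finset.univ.biUnion fun i => (Y i).val⟩

/-- Unions of finite sets depend measurably on the sets. The σ-algebra on the product of spaces of
finite sets being a product and not a quotient σ-algebra, this needs measurable enumerations. -/
theorem measurable_union [MeasurableSpace.CountablySeparated E] [Nonempty E] {ι : Type*}
    [Fintype ι] : Measurable (union (E := E) (ι := ι)) := by
  classical
  choose s hsm hs using exists_measurable_enumeration (E := E)
  intro B hB
  have : union (E := E) (ι := ι) ⁻¹' B = ⋃ c : ι → ℕ,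
      (⋂ i, {Y | (Y i).val.card = c i}) ∩
        (fun Y => (⟨Finset.univ.image fun p : Σ i, Fin (c i) => s (c p.1) (Y p.1) p.2⟩ :
          FinSet E)) ⁻¹' B := by
    ext Y
    have key : ∀ c : ι → ℕ, (∀ i, (Y i).val.card = c i) →
        (⟨Finset.univ.image fun p : Σ i, Fin (c i) => s (c p.1) (Y p.1) p.2⟩ : FinSet E) =
          union Y := by
      intro c hc
      ext a
      have h : ∀ i, a ∈ (Y i).val ↔ ∃ j, s (c i) (Y i) j = a := fun i => by
        conv_lhs => rw [← hs (c i) (Y i) (hc i)]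
        simp [toSet]
      simp [union, h]
    simp only [Set.mem_preimage, Set.mem_iUnion, Set.mem_inter_iff, Set.mem_iInter,
      Set.mem_ofPred_eq]
    constructor
    · intro h
      refine ⟨fun i => (Y i).val.card, fun _ => rfl, ?_⟩
      rwa [key _ fun _ => rfl]
    · rintro ⟨c, hc, h⟩
      rwa [key c hc] at h
  rw [this]
  refine .iUnion fun c => .inter (.iInter fun i => ?_) ?_
  · exact (measurable_card.comp (measurable_pi_apply i)) (measurableSet_singleton (c i))
  · refine (measurable_image.comp (measurable_pi_lambda _ fun p => ?_)) hB
    exact (measurable_pi_apply _).comp ((hsm _).comp (measurable_pi_apply _))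

theorem indepUnion_eq_map {ι : Type*} [Fintype ι] (P : ι → Measure (FinSet E)) :
    indepUnion P = (Measure.pi P).map union := rfl

end Measurability

/-! ### Finite product measures -/

section Pi

variable {ι κ : Type*} [Fintype ι] [Fintype κ]

theorem measurable_prod_coordinates {X : ι → Type*} [∀ i, MeasurableSpace (X i)]
    {f : ∀ i, X i → ℝ≥0∞} (hf : ∀ i, Measurable (f i)) :
    Measurable fun x : ∀ i, X i => ∏ i, f i (x i) :=
  Finset.measurable_prod _ fun i _ => (hf i).comp (measurable_pi_apply i)

omit [Fintype ι] [Fintype κ] in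
theorem measurable_comp_index {X : Type*} [MeasurableSpace X] (e : ι → κ) :
    Measurable fun (Y : κ → X) i => Y (e i) :=
  measurable_pi_lambda _ fun _ => measurable_pi_apply _

theorem lintegral_pi_fin_prod {n : ℕ} {X : Fin n → Type*} [∀ i, MeasurableSpace (X i)]
    (μ : ∀ i, Measure (X i)) [∀ i, SigmaFinite (μ i)] {f : ∀ i, X i → ℝ≥0∞}
    (hf : ∀ i, Measurable (f i)) :
    ∫⁻ x, ∏ i, f i (x i) ∂Measure.pi μ = ∏ i, ∫⁻ x, f i x ∂μ i := by
  induction n with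
  | zero => simp
  | succ n ih =>
    calc
      _ = ∫⁻ z : X 0 × (∀ i : Fin n, X i.succ), f 0 z.1 * ∏ i : Fin n, f i.succ (z.2 i)
            ∂(μ 0).prod (Measure.pi fun i : Fin n => μ i.succ) := by
          rw [← ((measurePreserving_piFinSuccAbove μ 0).symm _).lintegral_comp
            (measurable_prod_coordinates hf)]
          simp_rw [Fin.prod_univ_succ]
          rfl
      _ = (∫⁻ x, f 0 x ∂μ 0) * ∏ i : Fin n, ∫⁻ x, f i.succ x ∂μ i.succ := by
          rw [← ih (fun i => μ i.succ) (fun i => hf i.succ)]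
          exact lintegral_prod_mul (hf 0).aemeasurable
            (measurable_prod_coordinates fun i : Fin n => hf i.succ).aemeasurable
      _ = _ := by rw [Fin.prod_univ_succ]

/-- Tonelli's theorem for a product of functions of one coordinate each. -/
theorem lintegral_pi_prod {X : ι → Type*} [∀ i, MeasurableSpace (X i)]
    (μ : ∀ i, Measure (X i)) [∀ i, SigmaFinite (μ i)] {f : ∀ i, X i → ℝ≥0∞}
    (hf : ∀ i, Measurable (f i)) :
    ∫⁻ x, ∏ i, f i (x i) ∂Measure.pi μ = ∏ i, ∫⁻ x, f i x ∂μ i := by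
  let e := (Fintype.equivFin ι).symm
  rw [← (measurePreserving_piCongrLeft μ e).lintegral_comp
    (measurable_prod_coordinates hf)]
  simp_rw [← e.prod_comp, MeasurableEquiv.coe_piCongrLeft, Equiv.piCongrLeft_apply_apply]
  exact lintegral_pi_fin_prod (fun i => μ (e i)) fun i => hf (e i)

variable {X : Type*} [MeasurableSpace X]

theorem pi_withDensity (μ : ι → Measure X) [∀ i, SigmaFinite (μ i)] {f : ι → X → ℝ≥0∞}
    (hf : ∀ i, Measurable (f i)) [∀ i, SigmaFinite ((μ i).withDensity (f i))] :
    Measure.pi (fun i => (μ i).withDensity (f i)) =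
      (Measure.pi μ).withDensity fun x => ∏ i, f i (x i) := by
  classical
  refine Measure.pi_eq fun s hs => ?_
  rw [withDensity_apply _ (.univ_pi hs), ← lintegral_indicator (.univ_pi hs)]
  have : ∀ x : ι → X, (Set.univ.pi s).indicator (fun x => ∏ i, f i (x i)) x =
      ∏ i, (s i).indicator (f i) (x i) := by
    intro x
    by_cases hx : x ∈ Set.univ.pi s
    · rw [Set.indicator_of_mem hx]
      exact Finset.prod_congr rfl fun i _ => (Set.indicator_of_mem (hx i trivial) _).symm
    · rw [Set.indicator_of_notMem hx]
      obtain ⟨i, hi⟩ : ∃ i, x i ∉ s i := by simpa using hx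
      exact (Finset.prod_eq_zero (Finset.mem_univ i) (Set.indicator_of_notMem hi _)).symm
  simp_rw [this]
  rw [lintegral_pi_prod μ fun i => (hf i).indicator (hs i)]
  refine Finset.prod_congr rfl fun i _ => ?_
  rw [lintegral_indicator (hs i), withDensity_apply _ (hs i)]

/-- The marginal of a product of probability measures along an injective reindexing. -/
theorem pi_map_comp_injective (Q : κ → Measure X) [∀ k, IsProbabilityMeasure (Q k)] {e : ι → κ}
    (he : Function.Injective e) :
    (Measure.pi Q).map (fun Y i => Y (e i)) = Measure.pi fun i => Q (e i) := by
  classical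
  refine (Measure.pi_eq fun s hs => ?_).symm
  rw [Measure.map_apply (measurable_comp_index e) (.univ_pi hs)]
  let t : κ → Set X := fun k => {x | ∀ i, e i = k → x ∈ s i}
  have h1 : (fun (Y : κ → X) i => Y (e i)) ⁻¹' Set.univ.pi s = Set.univ.pi t := by
    ext Y
    simp only [Set.mem_preimage, Set.mem_pi, Set.mem_univ, true_imp_iff, t, Set.mem_ofPred_eq]
    exact ⟨fun h k i hk => hk ▸ h i, fun h i => h _ i rfl⟩
  have h2 : ∀ i, t (e i) = s i := fun i => by
    ext x
    exact ⟨fun h => h i rfl, fun h j hj => he hj ▸ h⟩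
  rw [h1, Measure.pi_pi]
  rw [← Finset.prod_subset (Finset.subset_univ (Finset.univ.image e)),
    Finset.prod_image he.injOn]
  · exact Finset.prod_congr rfl fun i _ => by rw [h2]
  · intro k _ hk
    have : t k = Set.univ := by
      ext x
      simp only [Set.mem_univ, iff_true]
      intro i hi
      exact absurd (Finset.mem_image.mpr ⟨i, Finset.mem_univ i, hi⟩) hk
    rw [this, measure_univ]

/-- The coordinates of a vector with independent components are almost surely distinct if the
components have no atoms. -/
theorem ae_injective_pi [MeasurableSpace.CountablySeparated X] (μ : ι → Measure X)
    [∀ i, SigmaFinite (μ i)] [∀ i, NullSingletonClass (μ i)] :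
    ∀ᵐ x ∂Measure.pi μ, Function.Injective x := by
  classical
  obtain ⟨φ, hφm, hφ⟩ := exists_measurable_injective_real (E := X)
  have h : ∀ i j, i ≠ j → ∀ᵐ x ∂Measure.pi μ, x i ≠ x j := by
    intro i j hij
    have hp := measurePreserving_piEquivPiSubtypeProd μ (fun k => k ≠ i)
    have hi : ¬ (i ≠ i) := by simp
    -- Fubini: given the other coordinates, coordinate `i` avoids the value of coordinate `j`.
    let S : Set (({k // k ≠ i} → X) × ({k // ¬ k ≠ i} → X)) := {z | z.2 ⟨i, hi⟩ = z.1 ⟨j, hij.symm⟩}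
    have hS : MeasurableSet S := by
      have : S = {z | φ (z.2 ⟨i, hi⟩) = φ (z.1 ⟨j, hij.symm⟩)} := by
        ext z; exact hφ.eq_iff.symm
      rw [this]
      exact measurableSet_eq_fun (hφm.comp ((measurable_pi_apply _).comp measurable_snd))
        (hφm.comp ((measurable_pi_apply _).comp measurable_fst))
    have h0 := (Measure.measure_prod_null (μ := Measure.pi fun k : {k // k ≠ i} => μ k)
      (ν := Measure.pi fun k : {k // ¬ k ≠ i} => μ k) hS).mpr
      (Filter.Eventually.of_forall fun y =>
        Measure.pi_hyperplane (fun k : {k // ¬ k ≠ i} => μ k) ⟨i, hi⟩ (y ⟨j, hij.symm⟩))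
    rw [← hp.measure_preimage hS.nullMeasurableSet] at h0
    rw [ae_iff]
    convert h0 using 2
    ext x
    simp only [ne_eq, not_not]
    rfl
  have h' : ∀ᵐ x ∂Measure.pi μ, ∀ i j, i ≠ j → x i ≠ x j := by
    rw [ae_all_iff]; intro i
    rw [ae_all_iff]; intro j
    by_cases hij : i = j
    · simp [hij]
    · simpa [hij] using h i j hij
  filter_upwards [h'] with x hx i j hij
  by_contra hne
  exact hx i j hne hij

/-- Multilinearity of the product measure, in the factors of the second block. -/
theorem pi_sumElim_add [DecidableEq ι] (b : κ → Measure X) [∀ l, IsProbabilityMeasure (b l)]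
    (r q : ι → ℝ≥0∞) (hr : ∀ i, r i ≠ ∞) (hq : ∀ i, q i ≠ ∞) (A C : ι → Measure X)
    [∀ i, IsProbabilityMeasure (A i)] [∀ i, IsProbabilityMeasure (C i)] :
    Measure.pi (Sum.elim b fun i => r i • A i + q i • C i) =
      ∑ s : Finset ι, ((∏ i ∈ s, r i) * ∏ i ∈ Finset.univ \ s, q i) •
        Measure.pi (Sum.elim b fun i => if i ∈ s then A i else C i) := by
  have h1 : ∀ j, SigmaFinite ((Sum.elim b fun i => r i • A i + q i • C i) j) := by
    rintro (l | i)
    · simp only [Sum.elim_inl]; infer_instance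
    · have := Measure.smul_finite (A i) (hr i)
      have := Measure.smul_finite (C i) (hq i)
      simp only [Sum.elim_inr]; infer_instance
  have h2 : ∀ (s : Finset ι) j,
      IsProbabilityMeasure ((Sum.elim b fun i => if i ∈ s then A i else C i) j) := by
    rintro s (l | i)
    · simp only [Sum.elim_inl]; infer_instance
    · simp only [Sum.elim_inr]; split_ifs <;> infer_instance
  refine Measure.pi_eq fun t ht => ?_
  simp only [Measure.coe_finsetSum, Finset.sum_apply, Measure.coe_smul, Pi.smul_apply,
    Measure.pi_pi, Fintype.prod_sum_type, Sum.elim_inl, Sum.elim_inr, smul_eq_mul,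
    Measure.coe_add, Pi.add_apply]
  rw [Finset.prod_add, Finset.powerset_univ, Finset.mul_sum]
  refine Finset.sum_congr rfl fun s _ => ?_
  have h3 : ∏ i, (if i ∈ s then A i else C i) (t (Sum.inr i)) =
      (∏ i ∈ s, A i (t (Sum.inr i))) * ∏ i ∈ Finset.univ \ s, C i (t (Sum.inr i)) := by
    rw [← Finset.prod_sdiff (Finset.subset_univ s), mul_comm]
    congr 1
    · exact Finset.prod_congr rfl fun i hi => by rw [if_pos hi]
    · exact Finset.prod_congr rfl fun i hi => by rw [if_neg (Finset.mem_sdiff.mp hi).2]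
  rw [h3, Finset.prod_mul_distrib, Finset.prod_mul_distrib]
  ring

theorem measurable_pi_measure {Y : Type*} [MeasurableSpace Y] {K : ι → Y → Measure X}
    [∀ i y, IsProbabilityMeasure (K i y)] (hK : ∀ i, Measurable (K i)) :
    Measurable fun y => Measure.pi fun i => K i y := by
  refine Measurable.measure_of_isPiSystem_of_isProbabilityMeasure
    generateFrom_pi.symm isPiSystem_pi ?_
  rintro _ ⟨s, hs, rfl⟩
  simp_rw [Measure.pi_pi]
  exact Finset.measurable_prod _ fun i _ =>
    (Measure.measurable_coe (hs i trivial)).comp (hK i)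

theorem isProbabilityMeasure_bind {Y : Type*} [MeasurableSpace Y] (Q : Measure Y)
    [IsProbabilityMeasure Q] {K : Y → Measure X} [∀ y, IsProbabilityMeasure (K y)]
    (hK : Measurable K) : IsProbabilityMeasure (Q.bind K) :=
  ⟨by rw [Measure.bind_apply .univ hK.aemeasurable]; simp⟩

/-- Drawing independent inputs and moving them independently gives independent outputs; the first
block of outputs does not depend on the inputs. -/
theorem pi_bind_pi_sumElim {Y : Type*} [MeasurableSpace Y] (b : κ → Measure X)
    [∀ l, IsProbabilityMeasure (b l)] (Q : ι → Measure Y) [∀ i, IsProbabilityMeasure (Q i)]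
    (K : ι → Y → Measure X) [∀ i y, IsProbabilityMeasure (K i y)] (hK : ∀ i, Measurable (K i)) :
    (Measure.pi Q).bind (fun y => Measure.pi (Sum.elim b fun i => K i (y i))) =
      Measure.pi (Sum.elim b fun i => (Q i).bind (K i)) := by
  have h1 : ∀ j, IsProbabilityMeasure ((Sum.elim b fun i => (Q i).bind (K i)) j) := by
    rintro (l | i)
    · simp only [Sum.elim_inl]; infer_instance
    · exact isProbabilityMeasure_bind (Q i) (hK i)
  have h2 : ∀ j (y : ι → Y), IsProbabilityMeasure ((Sum.elim b fun i => K i (y i)) j) := by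
    rintro (l | i) y
    · simp only [Sum.elim_inl]; infer_instance
    · simp only [Sum.elim_inr]; infer_instance
  have hm : Measurable fun y : ι → Y => Measure.pi (Sum.elim b fun i => K i (y i)) := by
    refine measurable_pi_measure (K := fun j (y : ι → Y) => (Sum.elim b fun i => K i (y i)) j) ?_
    rintro (l | i)
    · exact measurable_const
    · exact (hK i).comp (measurable_pi_apply i)
  refine (Measure.pi_eq fun t ht => ?_).symm
  rw [Measure.bind_apply (.univ_pi ht) hm.aemeasurable]
  simp only [Measure.pi_pi, Fintype.prod_sum_type, Sum.elim_inl, Sum.elim_inr]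
  have hf : ∀ i, Measurable fun y => K i y (t (Sum.inr i)) := fun i =>
    (Measure.measurable_coe (ht _)).comp (hK i)
  rw [lintegral_const_mul _ (measurable_prod_coordinates hf), lintegral_pi_prod Q hf]
  congr 1
  exact Finset.prod_congr rfl fun i _ => (Measure.bind_apply (ht _) (hK i).aemeasurable).symm

end Pi

/-! ### Decompositions of a finite set into Bernoulli components -/

section Decompositions

variable {E : Type*}

/-- The probability that exactly the Bernoulli components with index in `s` are nonempty. -/
noncomputable def bernoulliWeight {ι : Type*} [Fintype ι] [DecidableEq ι]
    (r : ι → ℝ≥0∞) (s : Finset ι) : ℝ≥0∞ :=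
  (∏ i ∈ s, r i) * ∏ i ∈ Finset.univ \ s, (1 - r i)

open Classical in
/-- The decompositions of `{x₁, …, x_N}` into `n` disjoint sets correspond to the assignments of
the indices `1, …, N` to the components `1, …, n`. -/
theorem sum_decompositions {N n : ℕ} {x : Fin N → E} (hx : Function.Injective x)
    (F : (Fin n → Finset E) → ℝ≥0∞) :
    ∑ Y ∈ decompositions n (toSet N x).val, F Y =
      ∑ g : Fin N → Fin n, F fun i => (Finset.univ.filter fun j => g j = i).image x := by
  symm
  refine Finset.sum_bij (fun g _ i => (Finset.univ.filter fun j => g j = i).image x) ?_ ?_ ?_ ?_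
  · intro g _
    simp only [decompositions, Finset.mem_filter, Fintype.mem_piFinset, Finset.mem_powerset]
    refine ⟨fun i => Finset.image_subset_image (Finset.filter_subset _ _), fun i i' hii => ?_, ?_⟩
    · change Disjoint _ _
      rw [Finset.disjoint_image hx]
      exact Finset.disjoint_filter.mpr fun j _ h h' => hii (h.symm.trans h')
    · ext a
      simp [toSet]
  · intro g _ g' _ h
    funext j
    have h1 : x j ∈ (Finset.univ.filter fun k => g k = g j).image x :=
      Finset.mem_image_of_mem _ (by simp)
    have h2 := congrFun h (g j)
    rw [h2] at h1
    obtain ⟨k, hk, hkj⟩ := Finset.mem_image.mp h1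
    rw [← hx hkj]
    rw [hx hkj] at hk ⊢
    exact (Finset.mem_filter.mp hk).2.symm
  · intro Y hY
    simp only [decompositions, Finset.mem_filter, Fintype.mem_piFinset, Finset.mem_powerset] at hY
    obtain ⟨h1, h2, h3⟩ := hY
    have h4 : ∀ j, ∃ i, x j ∈ Y i := fun j => by
      have : x j ∈ Finset.univ.biUnion Y := by rw [h3]; simp [toSet]
      simpa using this
    choose g hg using h4
    refine ⟨g, Finset.mem_univ _, ?_⟩
    funext i
    ext a
    simp only [Finset.mem_image, Finset.mem_filter, Finset.mem_univ, true_and]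
    constructor
    · rintro ⟨j, rfl, rfl⟩
      exact hg j
    · intro ha
      obtain ⟨j, -, rfl⟩ := Finset.mem_image.mp (h1 i ha)
      refine ⟨j, ?_, rfl⟩
      by_contra hne
      exact Finset.disjoint_left.mp (h2 hne) (hg j) ha
  · intro g _; rfl

open Classical in
theorem sum_decompositions_bernoulli {N n : ℕ} {x : Fin N → E} (hx : Function.Injective x)
    (r : Fin n → ℝ≥0∞) (f : Fin n → E → ℝ≥0∞) :
    ∑ Y ∈ decompositions n (toSet N x).val, ∏ i, bernoulliDensity (r i) (f i) (Y i) =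
      ∑ g : Fin N → Fin n, if Function.Injective g then
        bernoulliWeight r (Finset.univ.image g) * ∏ j, f (g j) (x j) else 0 := by
  rw [sum_decompositions hx]
  refine Finset.sum_congr rfl fun g _ => ?_
  split_ifs with hg
  · have h1 : ∀ j, bernoulliDensity (r (g j)) (f (g j))
        ((Finset.univ.filter fun k => g k = g j).image x) = r (g j) * f (g j) (x j) := by
      intro j
      have : (Finset.univ.filter fun k => g k = g j) = {j} := by
        ext k; simp [hg.eq_iff]
      rw [this, Finset.image_singleton, bernoulliDensity_singleton]
    have h2 : ∀ i ∈ Finset.univ \ Finset.univ.image g, bernoulliDensity (r i) (f i)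
        ((Finset.univ.filter fun k => g k = i).image x) = 1 - r i := by
      intro i hi
      have : (Finset.univ.filter fun k => g k = i) = ∅ := by
        ext k
        simp only [Finset.mem_sdiff, Finset.mem_image, not_exists] at hi
        simpa using fun h => hi.2 k ⟨Finset.mem_univ _, h⟩
      rw [this, Finset.image_empty, bernoulliDensity_empty]
    rw [← Finset.prod_sdiff (Finset.subset_univ (Finset.univ.image g)), Finset.prod_congr rfl h2,
      Finset.prod_image hg.injOn, Finset.prod_congr rfl fun j _ => h1 j, Finset.prod_mul_distrib,
      bernoulliWeight, Finset.prod_image hg.injOn]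
    ring
  · obtain ⟨j, j', hj, hne⟩ : ∃ j j', g j = g j' ∧ j ≠ j' := by
      simpa [Function.Injective] using hg
    refine Finset.prod_eq_zero (Finset.mem_univ (g j)) ?_
    have : 1 < ((Finset.univ.filter fun k => g k = g j).image x).card := by
      rw [Finset.card_image_of_injective _ hx, Finset.one_lt_card]
      exact ⟨j, by simp, j', by simp [hj], hne⟩
    exact (if_neg (Nat.ne_zero_of_lt this)).trans (if_neg this.ne')

open Classical in
/-- Every `N`-element set is the range of exactly `N!` injective maps from an `N`-element type. -/
theorem sum_injective_image {N n : ℕ} (W : Finset (Fin n) → ℝ≥0∞) :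
    ∑ g : Fin N → Fin n, (if Function.Injective g then W (Finset.univ.image g) else 0) =
      N.factorial * ∑ s : Finset (Fin n), if s.card = N then W s else 0 := by
  rw [← Finset.sum_filter, ← Finset.sum_fiberwise_of_maps_to
    (t := Finset.univ) (g := fun g : Fin N → Fin n => Finset.univ.image g)
    (fun _ _ => Finset.mem_univ _), Finset.mul_sum]
  refine Finset.sum_congr rfl fun s _ => ?_
  rw [Finset.filter_filter]
  rw [Finset.sum_congr rfl (g := fun _ => W s)
    (fun g hg => by rw [(Finset.mem_filter.mp hg).2.2])]
  rw [Finset.sum_const, nsmul_eq_mul]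
  split_ifs with hs
  · congr 2
    let e : {g : Fin N → Fin n // Function.Injective g ∧ Finset.univ.image g = s} ≃ (Fin N ↪ s) :=
      { toFun := fun g => ⟨fun j => ⟨g.1 j, (Finset.ext_iff.mp g.2.2 _).mp (by simp)⟩,
          fun j j' h => g.2.1 (congrArg Subtype.val h)⟩
        invFun := fun φ => ⟨fun j => φ j, by
          have hinj : Function.Injective fun j => (φ j : Fin n) :=
            Subtype.val_injective.comp φ.injective
          refine ⟨hinj, Finset.eq_of_subset_of_card_le ?_ ?_⟩
          · intro a ha
            obtain ⟨j, -, rfl⟩ := Finset.mem_image.mp ha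
            exact (φ j).2
          · rw [Finset.card_image_of_injective _ hinj, hs]; simp⟩
        left_inv := fun g => rfl
        right_inv := fun φ => rfl }
    rw [← Fintype.card_subtype, Fintype.card_congr e, Fintype.card_embedding_eq]
    simp [hs, Nat.descFactorial_self]
  · rw [mul_zero]
    convert zero_mul _
    rw [Nat.cast_eq_zero, Finset.card_eq_zero, Finset.filter_eq_empty_iff]
    rintro g - ⟨hg, rfl⟩
    exact hs (by rw [Finset.card_image_of_injective _ hg]; simp)

theorem decompositions_one (X : Finset E) : decompositions 1 X = {fun _ => X} := by
  classical
  ext Y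
  simp only [decompositions, Finset.mem_filter, Fintype.mem_piFinset, Finset.mem_powerset,
    Finset.mem_singleton]
  constructor
  · rintro ⟨-, -, rfl⟩
    funext i
    rw [Subsingleton.elim i 0]
    simp
  · rintro rfl
    exact ⟨fun _ => subset_rfl, fun i j h => absurd (Subsingleton.elim i j) h, by simp⟩

end Decompositions

/-! ### Independent unions and multi-Bernoulli laws -/

section MultiBernoulli

variable {E : Type*} [MeasurableSpace E] [MeasurableSpace.CountablySeparated E]

theorem measurableSet_empty_finSet : MeasurableSet {S : FinSet E | S.val = ∅} := by
  have : {S : FinSet E | S.val = ∅} = (fun S : FinSet E => S.val.card) ⁻¹' {0} := by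
    ext S; simp
  rw [this]
  exact measurable_card (measurableSet_singleton 0)

/-- Components that are almost surely empty can be dropped from an independent union. -/
theorem indepUnion_eq_of_injective [Nonempty E] {ι κ : Type*} [Fintype ι] [Fintype κ]
    {P : ι → Measure (FinSet E)}
    {Q : κ → Measure (FinSet E)} [∀ k, IsProbabilityMeasure (Q k)] {e : ι → κ}
    (he : Function.Injective e) (hP : ∀ i, P i = Q (e i))
    (hQ : ∀ k, k ∉ Set.range e → Q k = Measure.dirac ⟨∅⟩) : indepUnion Q = indepUnion P := by
  classical
  obtain rfl : P = fun i => Q (e i) := funext hP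
  rw [indepUnion_eq_map, indepUnion_eq_map, ← pi_map_comp_injective Q he,
    Measure.map_map measurable_union (measurable_comp_index e)]
  refine Measure.map_congr ?_
  have h : ∀ᵐ Y ∂Measure.pi Q, ∀ k, k ∉ Set.range e → (Y k).val = ∅ := by
    rw [ae_all_iff]
    intro k
    by_cases hk : k ∈ Set.range e
    · simp [hk]
    · have h0 : ∀ᵐ S ∂Q k, S.val = ∅ := by
        rw [hQ k hk, ae_dirac_iff measurableSet_empty_finSet]
      have h1 := (measurePreserving_eval Q k).quasiMeasurePreserving.ae h0
      filter_upwards [h1] with Y hY _ using hY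
  filter_upwards [h] with Y hY
  ext a
  simp only [union, Function.comp, Finset.mem_biUnion, Finset.mem_univ, true_and]
  constructor
  · rintro ⟨k, hk⟩
    by_cases hke : k ∈ Set.range e
    · obtain ⟨i, rfl⟩ := hke
      exact ⟨i, hk⟩
    · rw [hY k hke] at hk
      simp at hk
  · rintro ⟨i, hi⟩
    exact ⟨_, hi⟩

/-- The law of a Bernoulli random finite set, the single object having law `Q`. -/
noncomputable def bernoulliLaw (r : ℝ≥0∞) (Q : Measure E) : Measure (FinSet E) :=
  r • Q.map (fun x => ⟨{x}⟩) + (1 - r) • Measure.dirac ⟨∅⟩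

omit [MeasurableSpace.CountablySeparated E] in
theorem isProbabilityMeasure_map_singleton (Q : Measure E) [IsProbabilityMeasure Q] :
    IsProbabilityMeasure (Q.map fun x => (⟨{x}⟩ : FinSet E)) :=
  Measure.isProbabilityMeasure_map measurable_singleton.aemeasurable

omit [MeasurableSpace.CountablySeparated E] in
theorem isProbabilityMeasure_bernoulliLaw {r : ℝ≥0∞} (hr : r ≤ 1) (Q : Measure E)
    [IsProbabilityMeasure Q] : IsProbabilityMeasure (bernoulliLaw r Q) := by
  have := isProbabilityMeasure_map_singleton Q
  exact ⟨by simp [bernoulliLaw, add_tsub_cancel_of_le hr]⟩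

/-- An independent union with Bernoulli components is a mixture over the sets of components that
are nonempty. -/
theorem indepUnion_sumElim_bernoulli [Nonempty E] {ι κ : Type*} [Fintype ι] [Fintype κ]
    [DecidableEq ι] (b : κ → Measure (FinSet E)) [∀ l, IsProbabilityMeasure (b l)]
    {r : ι → ℝ≥0∞} (hr : ∀ i, r i ≤ 1) (Q : ι → Measure E) [∀ i, IsProbabilityMeasure (Q i)] :
    indepUnion (Sum.elim b fun i => bernoulliLaw (r i) (Q i)) =
      ∑ s : Finset ι, bernoulliWeight r s • indepUnion (Sum.elim b fun i =>
        if i ∈ s then (Q i).map (fun x => ⟨{x}⟩) else Measure.dirac ⟨∅⟩) := by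
  have := fun i => isProbabilityMeasure_map_singleton (Q i)
  have h := pi_sumElim_add b r (fun i => 1 - r i) (fun i => ((hr i).trans_lt ENNReal.one_lt_top).ne)
    (fun i => (tsub_le_self.trans_lt ENNReal.one_lt_top).ne)
    (fun i => (Q i).map fun x => (⟨{x}⟩ : FinSet E)) (fun _ => Measure.dirac ⟨∅⟩)
  simp only [indepUnion_eq_map, bernoulliLaw]
  rw [h, ← Measure.mapₗ_apply_of_measurable measurable_union, map_sum]
  refine Finset.sum_congr rfl fun s _ => ?_
  rw [map_smul, Measure.mapₗ_apply_of_measurable measurable_union, bernoulliWeight]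

open Classical in
/-- A multi-Bernoulli law is a mixture, over the sets `s` of nonempty components, of the laws of
`{xᵢ : i ∈ s}` with independent `xᵢ`. -/
theorem indepUnion_bernoulli [Nonempty E] {ι : Type*} [Fintype ι] [DecidableEq ι]
    {r : ι → ℝ≥0∞} (hr : ∀ i, r i ≤ 1) (Q : ι → Measure E) [∀ i, IsProbabilityMeasure (Q i)] :
    indepUnion (fun i => bernoulliLaw (r i) (Q i)) =
      ∑ s : Finset ι, bernoulliWeight r s •
        (Measure.pi Q).map (fun x => (⟨s.image x⟩ : FinSet E)) := by
  have := fun i => isProbabilityMeasure_map_singleton (Q i)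
  have hb := fun i => isProbabilityMeasure_bernoulliLaw (hr i) (Q i)
  -- Expand with an empty first block, which is then dropped.
  let b : Fin 0 → Measure (FinSet E) := fun l => l.elim0
  have : ∀ l, IsProbabilityMeasure (b l) := fun l => l.elim0
  have drop : ∀ P : ι → Measure (FinSet E), (∀ i, IsProbabilityMeasure (P i)) →
      indepUnion (Sum.elim b P) = indepUnion P := by
    intro P hP
    have : ∀ j, IsProbabilityMeasure (Sum.elim b P j) := by
      rintro (l | i)
      · exact l.elim0
      · exact hP i
    refine indepUnion_eq_of_injective Sum.inr_injective (fun i => rfl) ?_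
    rintro (l | i) h
    · exact l.elim0
    · exact absurd ⟨i, rfl⟩ h
  rw [← drop _ hb, indepUnion_sumElim_bernoulli b hr]
  refine Finset.sum_congr rfl fun s _ => ?_
  have hs : ∀ i, IsProbabilityMeasure
      (if i ∈ s then (Q i).map (fun x => (⟨{x}⟩ : FinSet E)) else Measure.dirac ⟨∅⟩) := by
    intro i; split_ifs <;> infer_instance
  rw [drop _ hs]
  congr 1
  let F : ι → E → FinSet E := fun i x => if i ∈ s then ⟨{x}⟩ else ⟨∅⟩
  have hF : ∀ i, Measurable (F i) := by
    intro i
    by_cases hi : i ∈ s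
    · simp only [F, hi, if_true]; exact measurable_singleton
    · simp only [F, hi, if_false]; exact measurable_const
  have hFQ : ∀ i, (if i ∈ s then (Q i).map (fun x => (⟨{x}⟩ : FinSet E))
      else Measure.dirac ⟨∅⟩) = (Q i).map (F i) := by
    intro i
    by_cases hi : i ∈ s <;> simp [F, hi, Measure.map_const]
  have := fun i => Measure.isProbabilityMeasure_map (μ := Q i) (hF i).aemeasurable
  have hFm : Measurable fun (x : ι → E) i => F i (x i) :=
    measurable_pi_lambda _ fun i => (hF i).comp (measurable_pi_apply i)
  simp_rw [indepUnion_eq_map, hFQ]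
  rw [← Measure.pi_map_pi fun i => (hF i).aemeasurable, Measure.map_map measurable_union hFm]
  congr 1
  funext x
  ext a
  simp only [union, F, Function.comp, Finset.mem_biUnion, Finset.mem_univ, true_and,
    Finset.mem_image]
  refine exists_congr fun i => ?_
  split_ifs with hi <;> simp [hi, eq_comm]

theorem measurable_sum_decompositions {n : ℕ} (r : Fin n → ℝ≥0∞) {f : Fin n → E → ℝ≥0∞}
    (hf : ∀ i, Measurable (f i)) : Measurable fun S : FinSet E =>
      ∑ Y ∈ decompositions n S.val, ∏ i, bernoulliDensity (r i) (f i) (Y i) := by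
  classical
  refine measurable_finSet_of_injective _ (fun N => ?_)
    fun N x hx => sum_decompositions_bernoulli hx r f
  refine Finset.measurable_sum _ fun g _ => ?_
  split_ifs with hg
  · exact (measurable_prod_coordinates fun j => hf (g j)).const_mul _
  · exact measurable_const

omit [MeasurableSpace.CountablySeparated E] in
theorem isProbabilityMeasure_withDensity {ν : Measure E} {f : E → ℝ≥0∞}
    (hf : ∫⁻ x, f x ∂ν = 1) : IsProbabilityMeasure (ν.withDensity f) :=
  ⟨by rw [withDensity_apply _ .univ, Measure.restrict_univ, hf]⟩

/-- The set density of a multi-Bernoulli law: for a reference measure without atoms, the density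
`∑_{X¹ ⊎ ⋯ ⊎ Xⁿ = X} ∏ᵢ fᵢ(Xⁱ)` is that of the union of independent Bernoulli sets. The factor
`1 / N!` of the set integral cancels the `N!` orderings of the `N` nonempty components. -/
theorem withDensity_sum_decompositions [Nonempty E] (ν : Measure E) [SigmaFinite ν]
    [NullSingletonClass ν] {n : ℕ} {r : Fin n → ℝ≥0∞} (hr : ∀ i, r i ≤ 1) {f : Fin n → E → ℝ≥0∞}
    (hf : ∀ i, Measurable (f i)) (hf1 : ∀ i, ∫⁻ x, f i x ∂ν = 1) :
    (setMeasure ν).withDensity (fun S =>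
      ∑ Y ∈ decompositions n S.val, ∏ i, bernoulliDensity (r i) (f i) (Y i)) =
      indepUnion fun i => bernoulliLaw (r i) (ν.withDensity (f i)) := by
  classical
  have hQ : ∀ i, IsProbabilityMeasure (ν.withDensity (f i)) := fun i =>
    isProbabilityMeasure_withDensity (hf1 i)
  rw [indepUnion_bernoulli hr]
  ext B hB
  have hG := measurable_sum_decompositions r hf
  let J : Finset (Fin n) → ℝ≥0∞ := fun s =>
    (Measure.pi fun i => ν.withDensity (f i)).map (fun x => (⟨s.image x⟩ : FinSet E)) B
  have hJ : ∀ (N : ℕ) (g : Fin N → Fin n), Function.Injective g →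
      ∫⁻ x in toSet N ⁻¹' B, ∏ j, f (g j) (x j) ∂(Measure.pi fun _ => ν) =
        J (Finset.univ.image g) := by
    intro N g hg
    rw [← withDensity_apply _ (measurable_toSet N hB), ← pi_withDensity _ fun j => hf (g j),
      ← pi_map_comp_injective (fun i => ν.withDensity (f i)) hg,
      Measure.map_apply (measurable_comp_index g) (measurable_toSet N hB)]
    simp only [J]
    rw [Measure.map_apply (measurable_image_finset _) hB]
    congr 1
    ext x
    simp only [Set.mem_preimage]
    have : toSet N (fun j => x (g j)) = ⟨(Finset.univ.image g).image x⟩ := by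
      ext a; simp [toSet]
    rw [this]
  have hN : ∀ N : ℕ, ∫⁻ S in B, (∑ Y ∈ decompositions n S.val,
      ∏ i, bernoulliDensity (r i) (f i) (Y i)) ∂(Measure.pi fun _ : Fin N => ν).map (toSet N) =
      N.factorial * ∑ s : Finset (Fin n), if s.card = N then bernoulliWeight r s * J s else 0 := by
    intro N
    rw [setLIntegral_map hB hG (measurable_toSet N)]
    rw [lintegral_congr_ae (ae_restrict_of_ae ((ae_injective_pi fun _ : Fin N => ν).mono
      fun x hx => sum_decompositions_bernoulli hx r f))]
    rw [lintegral_finsetSum]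
    · rw [← sum_injective_image]
      refine Finset.sum_congr rfl fun g _ => ?_
      split_ifs with hg
      · rw [lintegral_const_mul _ (measurable_prod_coordinates fun j => hf (g j)), hJ N g hg]
      · simp
    · intro g _
      split_ifs with hg
      · exact (measurable_prod_coordinates fun j => hf (g j)).const_mul _
      · exact measurable_const
  rw [setMeasure, withDensity_sum, Measure.sum_apply _ hB]
  simp_rw [withDensity_smul_measure, Measure.smul_apply, withDensity_apply _ hB, hN, smul_eq_mul]
  have hfac : ∀ (N : ℕ) (t : ℝ≥0∞), (N.factorial : ℝ≥0∞)⁻¹ * (N.factorial * t) = t := by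
    intro N t
    rw [← mul_assoc, ENNReal.inv_mul_cancel, one_mul]
    · exact_mod_cast N.factorial_ne_zero
    · exact ENNReal.natCast_ne_top _
  simp_rw [hfac]
  rw [Summable.tsum_finsetSum fun _ _ => ENNReal.summable, Measure.coe_finsetSum, Finset.sum_apply]
  refine Finset.sum_congr rfl fun s _ => ?_
  rw [tsum_eq_single s.card fun N hN => if_neg hN.symm, if_pos rfl]
  rfl

theorem withDensity_bernoulliDensity [Nonempty E] (ν : Measure E) [SigmaFinite ν]
    [NullSingletonClass ν] {r : ℝ≥0∞} (hr : r ≤ 1) {f : E → ℝ≥0∞}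
    (hf : Measurable f) (hf1 : ∫⁻ x, f x ∂ν = 1) :
    (setMeasure ν).withDensity (fun S => bernoulliDensity r f S.val) =
      bernoulliLaw r (ν.withDensity f) := by
  have h := withDensity_sum_decompositions ν (n := 1) (r := fun _ => r) (fun _ => hr)
    (f := fun _ => f) (fun _ => hf) (fun _ => hf1)
  simp only [decompositions_one, Finset.sum_singleton, Finset.univ_unique, Finset.prod_singleton]
    at h
  rw [h]
  have : IsProbabilityMeasure (ν.withDensity f) := isProbabilityMeasure_withDensity hf1
  have := isProbabilityMeasure_bernoulliLaw hr (ν.withDensity f)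
  rw [indepUnion_eq_map]
  have hu : (union : (Fin 1 → FinSet E) → FinSet E) = Function.eval 0 := by
    funext Y; ext a; simp [union]
  rw [hu]
  exact (measurePreserving_eval (fun _ : Fin 1 => bernoulliLaw r (ν.withDensity f)) 0).map_eq

end MultiBernoulli

/-! ### The space of trajectories and its reference measure -/

section Sigma

variable {ι : Type*} {X : ι → Type*} [∀ i, MeasurableSpace (X i)]

theorem measurable_sigma_iff {β : Type*} [MeasurableSpace β] {g : (Σ i, X i) → β} :
    Measurable g ↔ ∀ i, Measurable fun x => g ⟨i, x⟩ := by
  constructor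
  · exact fun h i B hB => (MeasurableSpace.measurableSet_iInf.mp (h hB)) i
  · exact fun h B hB => MeasurableSpace.measurableSet_iInf.mpr fun i => h i hB

theorem measurable_sigma_mk (i : ι) : Measurable (Sigma.mk i : X i → Σ i, X i) :=
  measurable_sigma_iff.mp measurable_id i

theorem measurableEmbedding_sigma_mk (i : ι) :
    MeasurableEmbedding (Sigma.mk i : X i → Σ i, X i) where
  injective := sigma_mk_injective
  measurable := measurable_sigma_mk i
  measurableSet_image' := by
    intro A hA
    refine MeasurableSpace.measurableSet_iInf.mpr fun j => ?_
    change MeasurableSet (Sigma.mk j ⁻¹' (Sigma.mk i '' A))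
    by_cases h : i = j
    · subst h
      rwa [Set.preimage_image_eq _ sigma_mk_injective]
    · rw [Set.preimage_image_sigmaMk_of_ne (Ne.symm h)]
      exact .empty

end Sigma

theorem countablySeparated_of_injective {α β : Type*} [MeasurableSpace α] [MeasurableSpace β]
    [MeasurableSpace.CountablySeparated β] {g : α → β} (hg : Measurable g)
    (hi : Function.Injective g) : MeasurableSpace.CountablySeparated α := by
  obtain ⟨S, hS, hSm, hSs⟩ :=
    (inferInstance : HasCountableSeparatingOn β MeasurableSet Set.univ).exists_countable_separating
  refine ⟨⟨(fun s => g ⁻¹' s) '' S, hS.image _, ?_, ?_⟩⟩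
  · rintro _ ⟨s, hs, rfl⟩
    exact hg (hSm s hs)
  · intro x _ y _ h
    exact hi (hSs _ trivial _ trivial fun s hs => h _ ⟨s, hs, rfl⟩)

variable {d k : ℕ}

instance finite_span : Finite (Span k) :=
  Finite.of_injective (β := Fin (k + 1) × Fin (k + 1))
    (fun p => (⟨p.1.1, by have := p.2; omega⟩, ⟨p.1.2, by have := p.2; omega⟩)) <| by
    rintro ⟨⟨a, b⟩, h⟩ ⟨⟨a', b'⟩, h'⟩ hab
    simpa using hab

instance nonempty_trajectory : Nonempty (Trajectory d k) :=
  ⟨⟨⟨(0, 0), le_rfl, Nat.zero_le k⟩, fun _ => 0⟩⟩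

instance countablySeparated_trajectory :
    MeasurableSpace.CountablySeparated (Trajectory d k) := by
  let g : Trajectory d k → (ℕ × ℕ) × (ℕ → State d) := fun X =>
    (X.1.1, fun i => if h : i ∈ Finset.Icc X.1.1.1 X.1.1.2 then X.2 ⟨i, h⟩ else 0)
  refine countablySeparated_of_injective (g := g) ?_ ?_
  · refine measurable_sigma_iff.mpr fun p => Measurable.prodMk (f := fun _ => p.1)
      measurable_const (measurable_pi_lambda _ fun i => ?_)
    by_cases h : i ∈ Finset.Icc p.1.1 p.1.2
    · simp only [h, dif_pos]
      exact measurable_pi_apply (⟨i, h⟩ : Finset.Icc p.1.1 p.1.2)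
    · simp only [h]; exact measurable_const
  · rintro ⟨⟨p, hp⟩, x⟩ ⟨⟨q, hq⟩, y⟩ h
    obtain rfl : p = q := congrArg Prod.fst h
    congr 1
    funext i
    have := congrFun (congrArg Prod.snd h) i.1
    simpa [g, i.2] using this

instance sigmaFinite_trajMeasure : SigmaFinite (trajMeasure d k) := by
  have : ∀ p : Span k, SigmaFinite
      ((volume : Measure (Finset.Icc p.1.1 p.1.2 → State d)).map (Sigma.mk p)) :=
    fun p => (measurableEmbedding_sigma_mk (X := fun p : Span k =>
      Finset.Icc p.1.1 p.1.2 → State d) p).sigmaFinite_map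
  exact inferInstanceAs (SigmaFinite (Measure.sum _))

/-- Lebesgue measure on `ℝ^d` has no atoms for `d ≥ 1`, hence neither has the reference measure on
trajectories. -/
theorem nullSingletonClass_trajMeasure (hd : 0 < d) : NullSingletonClass (trajMeasure d k) := by
  have : Nonempty (Fin d) := ⟨⟨0, hd⟩⟩
  have : Nontrivial (State d) := inferInstance
  have : NullSingletonClass (volume : Measure (State d)) := inferInstance
  refine ⟨fun X => ?_⟩
  rw [trajMeasure, Measure.sum_apply_of_countable, ENNReal.tsum_eq_zero]
  intro p
  rw [(measurableEmbedding_sigma_mk (X := fun p : Span k =>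
      Finset.Icc p.1.1 p.1.2 → State d) p).map_apply]
  have : Nonempty (Finset.Icc p.1.1 p.1.2) := ⟨⟨p.1.1, Finset.mem_Icc.mpr ⟨le_rfl, p.2.1⟩⟩⟩
  have : NullSingletonClass (volume : Measure (Finset.Icc p.1.1 p.1.2 → State d)) := by
    rw [volume_pi]; infer_instance
  refine Set.Subsingleton.measure_zero ?_ _
  intro x hx y hy
  exact sigma_mk_injective (hx.trans hy.symm)

theorem lintegral_trajMeasure {g : Trajectory d k → ℝ≥0∞} (hg : Measurable g) :
    ∫⁻ X, g X ∂trajMeasure d k =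
      ∑' p : Span k, ∫⁻ x : Finset.Icc p.1.1 p.1.2 → State d, g ⟨p, x⟩ := by
  rw [trajMeasure, lintegral_sum_measure]
  exact tsum_congr fun p => lintegral_map hg (measurable_sigma_mk p)

/-! ### Extending trajectories by one time step -/

/-- The tuple `x_{β:ε}` with `y` appended at time `ε + 1`. -/
def snocState {β ε : ℕ} (z : (Finset.Icc β ε → State d) × State d) :
    Finset.Icc β (ε + 1) → State d :=
  fun κ => if h : κ.1 ≤ ε
    then z.1 ⟨κ.1, Finset.mem_Icc.mpr ⟨(Finset.mem_Icc.mp κ.2).1, h⟩⟩ else z.2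

theorem measurable_snocState {β ε : ℕ} :
    Measurable (snocState : (Finset.Icc β ε → State d) × State d → _) := by
  refine measurable_pi_lambda _ fun κ => ?_
  by_cases h : κ.1 ≤ ε
  · simp only [snocState, h, dif_pos]
    exact (measurable_pi_apply _).comp measurable_fst
  · simp only [snocState, h]
    exact measurable_snd

theorem measurePreserving_snocState {β ε : ℕ} (hβ : β ≤ ε + 1) :
    MeasurePreserving (snocState : (Finset.Icc β ε → State d) × State d → _)
      (volume.prod volume) volume := by
  refine ⟨measurable_snocState, (Measure.pi_eq fun s hs => ?_).symm⟩
  rw [Measure.map_apply measurable_snocState (.univ_pi hs)]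
  let e : Option (Finset.Icc β ε) ≃ Finset.Icc β (ε + 1) :=
    { toFun := fun o => o.elim ⟨ε + 1, Finset.mem_Icc.mpr ⟨hβ, le_rfl⟩⟩ fun i =>
        ⟨i.1, Finset.mem_Icc.mpr ⟨(Finset.mem_Icc.mp i.2).1,
          (Finset.mem_Icc.mp i.2).2.trans (Nat.le_succ ε)⟩⟩
      invFun := fun κ => if h : κ.1 ≤ ε
        then some ⟨κ.1, Finset.mem_Icc.mpr ⟨(Finset.mem_Icc.mp κ.2).1, h⟩⟩ else none
      left_inv := by
        rintro (_ | i)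
        · simp
        · simp [(Finset.mem_Icc.mp i.2).2]
      right_inv := by
        intro κ
        by_cases h : κ.1 ≤ ε
        · simp [h]
        · have := (Finset.mem_Icc.mp κ.2).2
          ext
          simp only [h, dite_false, Option.elim_none]
          omega }
  have hpre : snocState ⁻¹' Set.univ.pi s =
      (Set.univ.pi fun i => s (e (some i))) ×ˢ s (e none) := by
    ext z
    simp only [Set.mem_preimage, Set.mem_pi, Set.mem_univ, true_imp_iff, Set.mem_prod]
    rw [← e.forall_congr_right, Option.forall, and_comm]
    refine and_congr (forall_congr' fun i => ?_) ?_
    · have : snocState z (e (some i)) = z.1 i := by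
        simp [snocState, e, (Finset.mem_Icc.mp i.2).2]
      rw [this]
    · have : snocState z (e none) = z.2 := by simp [snocState, e]
      rw [this]
  rw [hpre, Measure.prod_prod, volume_pi, Measure.pi_pi, ← e.prod_comp, Fintype.prod_option,
    mul_comm]

/-- The time span of a trajectory alive at time `k`, after its extension to time `k + 1`. -/
def extendSpan (p : Span k) : Span (k + 1) :=
  ⟨(p.1.1, p.1.2 + 1), p.2.1.trans (Nat.le_succ _), Nat.succ_le_succ p.2.2⟩

/-- The time span of a trajectory, seen at time `k + 1`. -/
def keepSpan (p : Span k) : Span (k + 1) := ⟨p.1, p.2.1, p.2.2.trans (Nat.le_succ k)⟩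

/-- The time span of a trajectory born at time `k`. -/
def newSpan (k : ℕ) : Span k := ⟨(k, k), le_rfl, le_rfl⟩

theorem measurable_keep : Measurable (Trajectory.keep (d := d) (k := k)) :=
  measurable_sigma_iff.mpr fun p => measurable_sigma_mk (X := fun q : Span (k + 1) =>
    Finset.Icc q.1.1 q.1.2 → State d) (keepSpan p)

theorem measurable_extend_mk (p : Span k) :
    Measurable fun z : (Finset.Icc p.1.1 p.1.2 → State d) × State d =>
      Trajectory.extend (⟨p, z.1⟩ : Trajectory d k) z.2 :=
  (measurable_sigma_mk (X := fun q : Span (k + 1) =>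
    Finset.Icc q.1.1 q.1.2 → State d) (extendSpan p)).comp measurable_snocState

theorem measurable_extend (X : Trajectory d k) : Measurable X.extend :=
  (measurable_extend_mk X.1).comp measurable_prodMk_left

theorem measurable_last : Measurable (Trajectory.last (d := d) (k := k)) :=
  measurable_sigma_iff.mpr fun p => measurable_pi_apply
    (⟨p.1.2, Finset.mem_Icc.mpr ⟨p.2.1, le_rfl⟩⟩ : Finset.Icc p.1.1 p.1.2)

/-- A measurable function of the extended trajectory stays measurable when the new state is
integrated out. -/
theorem measurable_lintegral_extend {g : Trajectory d k → State d → ℝ≥0∞}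
    (hg : ∀ p, Measurable fun z : (Finset.Icc p.1.1 p.1.2 → State d) × State d =>
      g ⟨p, z.1⟩ z.2) : Measurable fun X => ∫⁻ y, g X y :=
  measurable_sigma_iff.mpr fun p => (hg p).lintegral_prod_right'

/-- The spans up to time `k + 1` are the spans up to time `k`, those of extended trajectories,
and that of the newborn trajectories. -/
theorem bijective_spanStep : Function.Bijective
    (Sum.elim keepSpan (Sum.elim (fun p : {p : Span k // p.1.2 = k} => extendSpan p.1)
      fun _ : Unit => newSpan (k + 1))) := by
  constructor
  · intro u v H
    have h1 := congrArg (fun q : Span (k + 1) => q.1.1) H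
    have h2 := congrArg (fun q : Span (k + 1) => q.1.2) H
    rcases u with p | p | _ <;> rcases v with q | q | _ <;>
      simp only [Sum.elim_inl, Sum.elim_inr, keepSpan, extendSpan, newSpan] at h1 h2
    · exact congrArg Sum.inl (Subtype.ext (Prod.ext h1 h2))
    · have := p.2; have := q.2; omega
    · have := p.2; omega
    · have := p.2; have := q.2; omega
    · exact congrArg (Sum.inr ∘ Sum.inl)
        (Subtype.ext (Subtype.ext (Prod.ext h1 (Nat.succ_injective h2))))
    · have := p.1.2; have := p.2; omega
    · have := q.2; omega
    · have := q.1.2; have := q.2; omega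
    · rfl
  · rintro ⟨⟨a, b⟩, h⟩
    simp only at h
    by_cases hb : b ≤ k
    · exact ⟨Sum.inl ⟨(a, b), h.1, hb⟩, rfl⟩
    · obtain rfl : b = k + 1 := by omega
      by_cases ha : a ≤ k
      · exact ⟨Sum.inr (Sum.inl ⟨⟨(a, k), ha, le_rfl⟩, rfl⟩), rfl⟩
      · obtain rfl : a = k + 1 := by omega
        exact ⟨Sum.inr (Sum.inr ()), rfl⟩

/-- The reference measure at time `k + 1` splits into kept, extended and newborn trajectories. -/
theorem lintegral_trajMeasure_succ {g : Trajectory d (k + 1) → ℝ≥0∞} (hg : Measurable g) :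
    ∫⁻ X, g X ∂trajMeasure d (k + 1) =
      ∫⁻ X, (g X.keep + if X.1.1.2 = k then ∫⁻ y, g (X.extend y) else 0) ∂trajMeasure d k +
        ∫⁻ x : Finset.Icc (k + 1) (k + 1) → State d, g ⟨newSpan (k + 1), x⟩ := by
  classical
  have := Fintype.ofFinite (Span k)
  have := Fintype.ofFinite (Span (k + 1))
  have hk : Measurable fun X : Trajectory d k => g X.keep := hg.comp measurable_keep
  have he : Measurable fun X : Trajectory d k => ∫⁻ y, g (X.extend y) :=
    measurable_lintegral_extend fun p => hg.comp (measurable_extend_mk p)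
  have he' : Measurable fun X : Trajectory d k =>
      if X.1.1.2 = k then ∫⁻ y, g (X.extend y) else 0 := by
    refine measurable_sigma_iff.mpr fun p => ?_
    by_cases h : p.1.2 = k
    · simp only [h, if_true]; exact measurable_sigma_iff.mp he p
    · simp only [h, if_false]; exact measurable_const
  rw [lintegral_add_left hk, lintegral_trajMeasure hg, lintegral_trajMeasure hk,
    lintegral_trajMeasure he', tsum_fintype, tsum_fintype, tsum_fintype,
    ← (Equiv.ofBijective _ (bijective_spanStep (k := k))).sum_comp]
  simp only [Fintype.sum_sum_type, Finset.univ_unique, Finset.sum_singleton]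
  rw [add_assoc]
  congr 2
  have hsum : ∀ G : Span k → ℝ≥0∞, ∑ p : Span k, (if p.1.2 = k then G p else 0) =
      ∑ p : {p : Span k // p.1.2 = k}, G p := by
    intro G
    rw [← Finset.sum_filter]
    exact Finset.sum_subtype _ (by simp) _
  have h1 : ∀ p : Span k, (∫⁻ x : Finset.Icc p.1.1 p.1.2 → State d,
      if p.1.2 = k then ∫⁻ y, g (Trajectory.extend ⟨p, x⟩ y) else 0) =
      if p.1.2 = k then ∫⁻ x : Finset.Icc p.1.1 p.1.2 → State d,
        ∫⁻ y, g (Trajectory.extend ⟨p, x⟩ y) else 0 := by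
    intro p
    split_ifs
    · rfl
    · simp
  simp_rw [h1]
  rw [hsum]
  refine Finset.sum_congr rfl fun p _ => ?_
  have hm : Measurable fun x : Finset.Icc p.1.1.1 (p.1.1.2 + 1) → State d =>
    g ⟨extendSpan p.1, x⟩ := measurable_sigma_iff.mp hg (extendSpan p.1)
  have h2 := (measurePreserving_snocState (d := d)
    (p.1.2.1.trans (Nat.le_succ _))).lintegral_comp hm
  refine Eq.trans h2.symm ?_
  exact lintegral_prod _ (hm.comp measurable_snocState).aemeasurable

/-! ### The transition of one trajectory and the birth densities -/

namespace Dynamics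

variable {d k : ℕ} (D : Dynamics d)

theorem measurable_trajSurvival : Measurable (D.trajSurvival (k := k)) := by
  refine measurable_sigma_iff.mpr fun p => ?_
  by_cases h : p.1.2 = k
  · simp only [trajSurvival, h, if_true]
    exact measurable_sigma_iff.mp (D.measurable_survival.comp measurable_last) p
  · simp only [trajSurvival, h, if_false]; exact measurable_const

theorem trajSurvival_le_one (X : Trajectory d k) : D.trajSurvival X ≤ 1 := by
  rw [trajSurvival]
  split_ifs
  · exact D.survival_le_one _
  · exact zero_le

theorem measurable_trans_right (x : State d) : Measurable (D.trans x) :=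
  D.measurable_trans.comp measurable_prodMk_left

theorem measurable_trans_last (p : Span k) :
    Measurable fun z : (Finset.Icc p.1.1 p.1.2 → State d) × State d =>
      D.trans (Trajectory.last (⟨p, z.1⟩ : Trajectory d k)) z.2 :=
  D.measurable_trans.comp
    (((measurable_sigma_iff.mp measurable_last p).comp measurable_fst).prodMk measurable_snd)

theorem lintegral_trajTransition (X : Trajectory d k) {g : Trajectory d (k + 1) → ℝ≥0∞}
    (hg : Measurable g) :
    ∫⁻ Z, g Z ∂D.trajTransition X = (1 - D.trajSurvival X) * g X.keep +
      D.trajSurvival X * ∫⁻ y, D.trans X.last y * g (X.extend y) := by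
  rw [trajTransition, lintegral_add_measure, lintegral_smul_measure, lintegral_smul_measure,
    lintegral_dirac' _ hg, lintegral_map hg (measurable_extend X),
    lintegral_withDensity_eq_lintegral_mul _ (D.measurable_trans_right _)
      (g := fun y => g (X.extend y)) (hg.comp (measurable_extend X))]
  rfl

theorem measurable_lintegral_trajTransition {g : Trajectory d (k + 1) → ℝ≥0∞}
    (hg : Measurable g) : Measurable fun X : Trajectory d k => ∫⁻ Z, g Z ∂D.trajTransition X := by
  simp_rw [D.lintegral_trajTransition _ hg]
  exact ((measurable_const.sub D.measurable_trajSurvival).mul (hg.comp measurable_keep)).add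
    (D.measurable_trajSurvival.mul (measurable_lintegral_extend fun p =>
      (D.measurable_trans_last p).mul (hg.comp (measurable_extend_mk p))))

theorem measurable_trajTransition : Measurable (D.trajTransition (k := k)) := by
  refine Measure.measurable_of_measurable_coe _ fun A hA => ?_
  simp_rw [← lintegral_indicator_one hA]
  exact D.measurable_lintegral_trajTransition (measurable_one.indicator hA)

instance isProbabilityMeasure_trajTransition (X : Trajectory d k) :
    IsProbabilityMeasure (D.trajTransition X) := by
  refine ⟨?_⟩
  rw [← lintegral_one, D.lintegral_trajTransition X measurable_const]
  simp [D.lintegral_trans, tsub_add_cancel_of_le (D.trajSurvival_le_one X)]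

theorem innerTransition_keep (f : Trajectory d k → ℝ≥0∞) (X : Trajectory d k) :
    D.innerTransition f X.keep = f X * (1 - D.trajSurvival X) :=
  dif_pos X.1.2.2

theorem innerTransition_extend (f : Trajectory d k → ℝ≥0∞) {X : Trajectory d k}
    (hX : X.1.1.2 = k) (y : State d) :
    D.innerTransition f (X.extend y) = f X * (D.trajSurvival X * D.trans X.last y) := by
  obtain ⟨⟨⟨β, ε⟩, h1, h2⟩, x⟩ := X
  obtain rfl : ε = k := hX
  have e1 : ¬ (Trajectory.extend (⟨⟨(β, ε), h1, h2⟩, x⟩ : Trajectory d ε) y).1.1.2 ≤ ε :=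
    Nat.not_succ_le_self ε
  have e2 : (fun κ : Finset.Icc β ε => (Trajectory.extend (⟨⟨(β, ε), h1, h2⟩, x⟩ : Trajectory d ε)
      y).2 ⟨κ.1, Finset.mem_Icc.mpr ⟨(Finset.mem_Icc.mp κ.2).1,
        (Finset.mem_Icc.mp κ.2).2.trans (not_le.mp e1).le⟩⟩) = x := by
    funext κ
    exact dif_pos (Finset.mem_Icc.mp κ.2).2
  have e3 : (Trajectory.extend (⟨⟨(β, ε), h1, h2⟩, x⟩ : Trajectory d ε) y).last = y :=
    dif_neg e1
  refine (dif_neg e1).trans ((dif_pos h1).trans ?_)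
  rw [e3]
  exact congrArg (fun x' : Finset.Icc β ε → State d =>
    f ⟨⟨(β, ε), h1, le_rfl⟩, x'⟩ * (D.trajSurvival ⟨⟨(β, ε), h1, le_rfl⟩, x'⟩ *
      D.trans (Trajectory.last (⟨⟨(β, ε), h1, le_rfl⟩, x'⟩ : Trajectory d ε)) y)) e2

theorem innerTransition_new (f : Trajectory d k → ℝ≥0∞)
    (x : Finset.Icc (k + 1) (k + 1) → State d) :
    D.innerTransition f ⟨newSpan (k + 1), x⟩ = 0 :=
  (dif_neg (Nat.not_succ_le_self k)).trans (dif_neg (Nat.not_succ_le_self k))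

theorem measurable_innerTransition {f : Trajectory d k → ℝ≥0∞} (hf : Measurable f) :
    Measurable (D.innerTransition f) := by
  refine measurable_sigma_iff.mpr fun q => ?_
  by_cases hε : q.1.2 ≤ k
  · simp only [innerTransition, hε, dite_true]
    exact measurable_sigma_iff.mp (hf.mul (measurable_const.sub D.measurable_trajSurvival))
      (⟨q.1, q.2.1, hε⟩ : Span k)
  · by_cases hβ : q.1.1 ≤ k
    · simp only [innerTransition, hε, hβ, dite_true, dite_false]
      let p : Span k := ⟨(q.1.1, k), hβ, le_rfl⟩
      have hρ : Measurable fun (x : Finset.Icc q.1.1 q.1.2 → State d) =>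
          (fun κ => x ⟨κ.1, Finset.mem_Icc.mpr ⟨(Finset.mem_Icc.mp κ.2).1,
            (Finset.mem_Icc.mp κ.2).2.trans (not_le.mp hε).le⟩⟩ :
            Finset.Icc p.1.1 p.1.2 → State d) :=
        measurable_pi_lambda _ fun κ => measurable_pi_apply _
      have hlast := measurable_sigma_iff.mp (measurable_last (d := d) (k := k + 1)) q
      exact ((measurable_sigma_iff.mp hf p).comp hρ).mul
        (((measurable_sigma_iff.mp D.measurable_trajSurvival p).comp hρ).mul
          ((D.measurable_trans_last p).comp (hρ.prodMk hlast)))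
    · simp only [innerTransition, hε, hβ, dite_false]
      exact measurable_const

/-- `⟨f; π^a⟩` is the density of the law of a trajectory with density `f` after one transition. -/
theorem withDensity_bind_trajTransition {f : Trajectory d k → ℝ≥0∞} (hf : Measurable f) :
    ((trajMeasure d k).withDensity f).bind D.trajTransition =
      (trajMeasure d (k + 1)).withDensity (D.innerTransition f) := by
  ext A hA
  have hi : Measurable (A.indicator (1 : Trajectory d (k + 1) → ℝ≥0∞)) :=
    measurable_one.indicator hA
  have hm := D.measurable_innerTransition hf
  rw [Measure.bind_apply hA D.measurable_trajTransition.aemeasurable]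
  simp_rw [← lintegral_indicator_one hA]
  rw [lintegral_withDensity_eq_lintegral_mul _ hf (D.measurable_lintegral_trajTransition hi),
    lintegral_withDensity_eq_lintegral_mul _ hm hi, lintegral_trajMeasure_succ (hm.mul hi)]
  simp only [Pi.mul_apply, innerTransition_new, zero_mul, lintegral_zero, add_zero]
  refine lintegral_congr fun X => ?_
  rw [D.lintegral_trajTransition X hi, innerTransition_keep, mul_add, mul_assoc]
  congr 1
  split_ifs with hX
  · simp_rw [D.innerTransition_extend f hX, mul_assoc]
    have h1 : Measurable fun y => D.trans X.last y * A.indicator 1 (X.extend y) :=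
      (D.measurable_trans_right _).mul (hi.comp (measurable_extend X))
    rw [lintegral_const_mul _ (h1.const_mul _), lintegral_const_mul _ h1]
  · simp [trajSurvival, hX]

theorem lintegral_innerTransition {f : Trajectory d k → ℝ≥0∞} (hf : Measurable f)
    (hf1 : ∫⁻ X, f X ∂trajMeasure d k = 1) :
    ∫⁻ X, D.innerTransition f X ∂trajMeasure d (k + 1) = 1 := by
  have := isProbabilityMeasure_withDensity hf1
  have h := isProbabilityMeasure_bind ((trajMeasure d k).withDensity f)
    D.measurable_trajTransition
  rw [D.withDensity_bind_trajTransition hf] at h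
  rw [← setLIntegral_univ, ← withDensity_apply _ .univ]
  exact h.measure_univ

theorem measurable_persistLaw : Measurable (D.persistLaw (k := k)) :=
  (Measure.measurable_map _ measurable_singleton).comp D.measurable_trajTransition

instance isProbabilityMeasure_persistLaw (X : Trajectory d k) :
    IsProbabilityMeasure (D.persistLaw X) :=
  isProbabilityMeasure_map_singleton _

end Dynamics

section Birth

variable {d k : ℕ}

theorem measurable_birthDensity {f : State d → ℝ≥0∞} (hf : Measurable f) :
    Measurable (birthDensity k f) := by
  refine measurable_sigma_iff.mpr fun p => ?_
  by_cases h : p.1.1 = k ∧ p.1.2 = k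
  · simp only [birthDensity, h, and_self, if_true]
    exact measurable_sigma_iff.mp (hf.comp measurable_last) p
  · simp only [birthDensity, h, if_false]; exact measurable_const

theorem lintegral_birthDensity {f : State d → ℝ≥0∞} (hf : Measurable f)
    (hf1 : ∫⁻ x, f x = 1) : ∫⁻ X, birthDensity (k + 1) f X ∂trajMeasure d (k + 1) = 1 := by
  rw [lintegral_trajMeasure_succ (measurable_birthDensity hf)]
  have h1 : ∀ X : Trajectory d k, birthDensity (k + 1) f X.keep = 0 := fun X =>
    if_neg fun h => by have h1 := X.1.2.2; have h2 : X.1.1.2 = k + 1 := h.2; omega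
  have h2 : ∀ (X : Trajectory d k) y, birthDensity (k + 1) f (X.extend y) = 0 := fun X y =>
    if_neg fun h => by
      have h1 := X.1.2.1; have h2 := X.1.2.2; have h3 : X.1.1.1 = k + 1 := h.1; omega
  have h3 : ∀ x : Finset.Icc (k + 1) (k + 1) → State d,
      birthDensity (k + 1) f ⟨newSpan (k + 1), x⟩ =
        f (x ⟨k + 1, Finset.mem_Icc.mpr ⟨le_rfl, le_rfl⟩⟩) := fun x => if_pos ⟨rfl, rfl⟩
  simp only [h1, h2, h3, lintegral_zero, ite_self, add_zero, zero_add]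
  let u : Unique (Finset.Icc (k + 1) (k + 1)) :=
    { default := ⟨k + 1, Finset.mem_Icc.mpr ⟨le_rfl, le_rfl⟩⟩
      uniq := fun i => Subtype.ext (le_antisymm (Finset.mem_Icc.mp i.2).2 (Finset.mem_Icc.mp i.2).1) }
  rw [← hf1, ← (volume_preserving_funUnique (Finset.Icc (k + 1) (k + 1)) (State d)).lintegral_comp
    hf]
  congr!

theorem birthLaw_eq_bernoulliLaw (hd : 0 < d) {r : ℝ≥0∞} (hr : r ≤ 1) {f : State d → ℝ≥0∞}
    (hf : Measurable f) (hf1 : ∫⁻ x, f x = 1) :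
    birthLaw (k + 1) r f =
      bernoulliLaw r ((trajMeasure d (k + 1)).withDensity (birthDensity (k + 1) f)) := by
  have := nullSingletonClass_trajMeasure (k := k + 1) hd
  exact withDensity_bernoulliDensity _ hr (measurable_birthDensity hf)
    (lintegral_birthDensity hf hf1)

end Birth

/-! ### Integrating the transition of sets against multi-Bernoulli laws -/

section Bind

variable {α β γ : Type*} [MeasurableSpace α] [MeasurableSpace β] [MeasurableSpace γ]

theorem bind_map_left (μ : Measure α) {g : α → β} (hg : Measurable g) {K : β → Measure γ}
    (hK : Measurable K) : (μ.map g).bind K = μ.bind fun x => K (g x) := by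
  rw [Measure.bind, Measure.bind, Measure.map_map hK hg]
  rfl

theorem map_bind (μ : Measure α) {K : α → Measure β} (hK : Measurable K) {g : β → γ}
    (hg : Measurable g) : (μ.bind K).map g = μ.bind fun x => (K x).map g := by
  ext A hA
  have hm : Measurable fun x => (K x).map g := (Measure.measurable_map g hg).comp hK
  rw [Measure.map_apply hg hA, Measure.bind_apply (hg hA) hK.aemeasurable,
    Measure.bind_apply hA hm.aemeasurable]
  exact lintegral_congr fun x => (Measure.map_apply hg hA).symm

theorem sum_smul_bind {ι : Type*} (s : Finset ι) (c : ι → ℝ≥0∞) (μ : ι → Measure α)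
    {K : α → Measure β} (hK : Measurable K) :
    (∑ i ∈ s, c i • μ i).bind K = ∑ i ∈ s, c i • (μ i).bind K := by
  ext A hA
  rw [Measure.bind_apply hA hK.aemeasurable, lintegral_finsetSum_measure]
  simp only [lintegral_smul_measure, Measure.coe_finsetSum, Finset.sum_apply, Measure.smul_apply]
  exact Finset.sum_congr rfl fun i _ => by rw [Measure.bind_apply hA hK.aemeasurable]

end Bind

section SetTransition

variable {d k nb : ℕ}

theorem isProbabilityMeasure_birthLaw (hd : 0 < d) (B : Birth d nb) (l : Fin nb) :
    IsProbabilityMeasure (birthLaw (k + 1) (B.r l) (B.f l)) := by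
  rw [birthLaw_eq_bernoulliLaw hd (B.r_le_one l) (B.measurable_f l) (B.lintegral_f l)]
  have := isProbabilityMeasure_withDensity
    (lintegral_birthDensity (k := k) (B.measurable_f l) (B.lintegral_f l))
  exact isProbabilityMeasure_bernoulliLaw (B.r_le_one l) _

variable (D : Dynamics d) (B : Birth d nb)

/-- The transition of the set `{xᵢ : i ∈ s}` with distinct `xᵢ`, as an independent union indexed
by the components and not by the elements of the set. -/
theorem setTransition_image (hd : 0 < d) {ι : Type*} [Fintype ι] [DecidableEq ι]
    {x : ι → Trajectory d k} (hx : Function.Injective x) {s : Finset ι} {S : FinSet (Trajectory d k)}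
    (hS : ∀ X, X ∈ S.val ↔ ∃ i ∈ s, x i = X) :
    D.setTransition B k S =
      indepUnion (Sum.elim (fun l => birthLaw (k + 1) (B.r l) (B.f l))
        fun i => if i ∈ s then D.persistLaw (x i) else Measure.dirac ⟨∅⟩) := by
  have hb := fun l => isProbabilityMeasure_birthLaw (k := k) hd B l
  have hprob : ∀ j, IsProbabilityMeasure ((Sum.elim
      (fun l => birthLaw (k + 1) (B.r l) (B.f l))
        fun i => if i ∈ s then D.persistLaw (x i) else Measure.dirac ⟨∅⟩ :
        Fin nb ⊕ ι → Measure (FinSet (Trajectory d (k + 1)))) j) := by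
    rintro (l | i)
    · exact hb l
    · simp only [Sum.elim_inr]
      split_ifs <;> infer_instance
  have hpre : ∀ X : {X // X ∈ S.val}, ∃ i, i ∈ s ∧ x i = X.1 := fun X => (hS _).mp X.2
  choose c hcs hc using hpre
  have hci : Function.Injective c := fun X Y h => Subtype.ext (by rw [← hc, ← hc, h])
  refine (indepUnion_eq_of_injective (e := Sum.map id c)
    (Function.injective_id.sumMap hci) ?_ ?_).symm
  · rintro (l | X)
    · rfl
    · simp only [Sum.elim_inr, Sum.map_inr]
      rw [if_pos (hcs X), hc]
  · rintro (l | i) h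
    · exact absurd ⟨Sum.inl l, rfl⟩ h
    · refine if_neg fun hi => h ⟨Sum.inr ⟨x i, (hS _).mpr ⟨i, hi, rfl⟩⟩, ?_⟩
      exact congrArg Sum.inr (hx (hc _))

theorem measurable_indepUnion_persist (hd : 0 < d) {ι : Type*} [Fintype ι] [DecidableEq ι]
    (s : Finset ι) :
    Measurable fun x : ι → Trajectory d k => Measure.pi
      (Sum.elim (fun l => birthLaw (k + 1) (B.r l) (B.f l))
        fun i => if i ∈ s then D.persistLaw (x i) else Measure.dirac ⟨∅⟩) := by
  have hb := fun l => isProbabilityMeasure_birthLaw (k := k) hd B l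
  let K : Fin nb ⊕ ι → (ι → Trajectory d k) → Measure (FinSet (Trajectory d (k + 1))) := fun j x =>
    Sum.elim (fun l => birthLaw (k + 1) (B.r l) (B.f l))
      (fun i => if i ∈ s then D.persistLaw (x i) else Measure.dirac ⟨∅⟩) j
  have hK : ∀ j x, IsProbabilityMeasure (K j x) := by
    rintro (l | i) x
    · exact hb l
    · simp only [K, Sum.elim_inr]
      split_ifs <;> infer_instance
  refine measurable_pi_measure (K := K) ?_
  rintro (l | i)
  · exact measurable_const
  · by_cases hi : i ∈ s
    · simp only [K, Sum.elim_inr, hi, if_true]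
      exact D.measurable_persistLaw.comp (measurable_pi_apply i)
    · simp only [K, Sum.elim_inr, hi, if_false]
      exact measurable_const

theorem measurable_setTransition (hd : 0 < d) : Measurable (D.setTransition B k) := by
  classical
  refine measurable_finSet_of_injective _ (fun N => (Measure.measurable_map _
    measurable_union).comp (measurable_indepUnion_persist D B hd (Finset.univ : Finset (Fin N))))
    fun N x hx => ?_
  exact setTransition_image D B hd hx fun X => by simp [toSet]

/-- The transition of a multi-Bernoulli set is multi-Bernoulli: almost surely the trajectories are
distinct, and then each of them moves independently of the others. -/
theorem indepUnion_bernoulli_bind_setTransition (hd : 0 < d) {ι : Type*} [Fintype ι]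
    {r : ι → ℝ≥0∞} (hr : ∀ i, r i ≤ 1) (Q : ι → Measure (Trajectory d k))
    [∀ i, IsProbabilityMeasure (Q i)] [∀ i, NullSingletonClass (Q i)] :
    (indepUnion fun i => bernoulliLaw (r i) (Q i)).bind (D.setTransition B k) =
      indepUnion (Sum.elim (fun l => birthLaw (k + 1) (B.r l) (B.f l))
        fun i => bernoulliLaw (r i) ((Q i).bind D.trajTransition)) := by
  classical
  have hm := measurable_setTransition (k := k) D B hd
  have hb := fun l => isProbabilityMeasure_birthLaw (k := k) hd B l
  have hQ := fun i => isProbabilityMeasure_bind (Q i) D.measurable_trajTransition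
  rw [indepUnion_bernoulli hr, sum_smul_bind _ _ _ hm, indepUnion_sumElim_bernoulli _ hr]
  refine Finset.sum_congr rfl fun s _ => ?_
  congr 1
  let K : ι → Trajectory d k → Measure (FinSet (Trajectory d (k + 1))) := fun i X =>
    if i ∈ s then D.persistLaw X else Measure.dirac ⟨∅⟩
  have hK1 : ∀ i X, IsProbabilityMeasure (K i X) := by
    intro i X
    simp only [K]
    split_ifs <;> infer_instance
  have hK : ∀ i, Measurable (K i) := by
    intro i
    by_cases hi : i ∈ s
    · simp only [K, hi, if_true]; exact D.measurable_persistLaw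
    · simp only [K, hi, if_false]; exact measurable_const
  have hQK : ∀ i, (Q i).bind (K i) = if i ∈ s then ((Q i).bind D.trajTransition).map
      (fun X => ⟨{X}⟩) else Measure.dirac ⟨∅⟩ := by
    intro i
    by_cases hi : i ∈ s
    · simp only [K, hi, if_true]
      exact (map_bind _ D.measurable_trajTransition measurable_singleton).symm
    · simp [K, hi]
  rw [bind_map_left _ (measurable_image_finset s) hm, Measure.bind_congr_right
    ((ae_injective_pi Q).mono fun x hx => setTransition_image D B hd hx (s := s)
      fun X => by simp)]
  simp_rw [indepUnion_eq_map]
  rw [← map_bind _ (measurable_indepUnion_persist D B hd s) measurable_union]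
  have h := pi_bind_pi_sumElim (fun l => birthLaw (k + 1) (B.r l) (B.f l)) Q K hK
  simp_rw [hQK] at h
  rw [← h]

end SetTransition

/-! ### Mixtures -/

section Mixture

variable {d k n nb : ℕ}

theorem mbmLaw_eq_sum (hd : 0 < d) {m : ℕ → ℕ} {k' : ℕ} {T : Fin n → Track d k}
    (hT : IsMBM m k' T) :
    mbmLaw m k' T = ∑ a ∈ globalHypotheses m k' T, globalWeight m k' T a •
      indepUnion fun i => bernoulliLaw ((T i).r (a i))
        ((trajMeasure d k).withDensity ((T i).f (a i))) := by
  have := nullSingletonClass_trajMeasure (k := k) hd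
  have hmeas := fun a : (i : Fin n) → Fin (T i).h =>
    measurable_sum_decompositions (fun i => (T i).r (a i)) fun i => hT.measurable_f i (a i)
  ext A hA
  simp only [mbmLaw, mbmDensity, withDensity_apply _ hA, Measure.coe_finsetSum, Finset.sum_apply,
    Measure.smul_apply, smul_eq_mul]
  rw [lintegral_finsetSum _ fun a _ => (hmeas a).const_mul _]
  refine Finset.sum_congr rfl fun a _ => ?_
  rw [lintegral_const_mul _ (hmeas a), ← withDensity_apply _ hA,
    withDensity_sum_decompositions _ (fun i => hT.r_le_one i (a i))
      (fun i => hT.measurable_f i (a i)) fun i => hT.lintegral_f i (a i)]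

/-- The parameters of a single-trajectory hypothesis: history, weight, existence probability and
density. -/
def Track.params (t : Track d k) (a : Fin t.h) :
    Finset (ℕ × ℕ) × ℝ≥0∞ × ℝ≥0∞ × (Trajectory d k → ℝ≥0∞) :=
  (t.M a, t.w a, t.r a, t.f a)

/-- A choice of hypotheses for two lists of tracks joined together amounts to a choice for each of
the lists. -/
theorem exists_equiv_append (T₁ : Fin n → Track d k) (T₂ : Fin nb → Track d k) :
    ∃ e : (((i : Fin n) → Fin (T₁ i).h) × ((l : Fin nb) → Fin (T₂ l).h)) ≃
        ((i : Fin (n + nb)) → Fin (Fin.append T₁ T₂ i).h),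
      ∀ a, (∀ i, (Fin.append T₁ T₂ (Fin.castAdd nb i)).params (e a (Fin.castAdd nb i)) =
          (T₁ i).params (a.1 i)) ∧
        ∀ l, (Fin.append T₁ T₂ (Fin.natAdd n l)).params (e a (Fin.natAdd n l)) =
          (T₂ l).params (a.2 l) := by
  have h1 : T₁ = fun i => Fin.append T₁ T₂ (Fin.castAdd nb i) := by simp
  have h2 : T₂ = fun l => Fin.append T₁ T₂ (Fin.natAdd n l) := by simp
  -- With the joined list as the variable, no casts between the index types are needed.
  generalize Fin.append T₁ T₂ = T at h1 h2
  subst h1 h2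
  exact ⟨{ toFun := fun a i => Fin.addCases (motive := fun i => Fin (T i).h) a.1 a.2 i
           invFun := fun a => (fun i => a (Fin.castAdd nb i), fun l => a (Fin.natAdd n l))
           left_inv := fun a => by simp
           right_inv := fun a => by
            funext i
            refine Fin.addCases (fun i => ?_) (fun l => ?_) i <;> simp },
    fun a => ⟨fun i => by simp, fun l => by simp⟩⟩

/-- The global hypotheses of the predicted tracks are those of the prior tracks, the new tracks
having a single hypothesis each. -/
theorem exists_equiv_predict (D : Dynamics d) (B : Birth d nb) (T : Fin n → Track d k) :
    ∃ e : ((i : Fin n) → Fin (T i).h) ≃ ((i : Fin (n + nb)) → Fin (predict D B T i).h),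
      ∀ a, (∀ i, (predict D B T (Fin.castAdd nb i)).params (e a (Fin.castAdd nb i)) =
          ((T i).M (a i), (T i).w (a i), (T i).r (a i), D.innerTransition ((T i).f (a i)))) ∧
        ∀ l, (predict D B T (Fin.natAdd n l)).params (e a (Fin.natAdd n l)) =
          (∅, 1, B.r l, birthDensity (k + 1) (B.f l)) := by
  obtain ⟨e, he⟩ := exists_equiv_append (fun i => (T i).predict D)
    (fun l => Track.birth (k + 1) (B.r l) (B.f l))
  have u : ∀ l : Fin nb, Unique (Fin (Track.birth (d := d) (k + 1) (B.r l) (B.f l)).h) :=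
    fun _ => inferInstanceAs (Unique (Fin 1))
  refine ⟨(Equiv.prodUnique ((i : Fin n) → Fin (T i).h)
    ((l : Fin nb) → Fin (Track.birth (d := d) (k + 1) (B.r l) (B.f l)).h)).symm.trans e,
    fun a => ⟨fun i => (he _).1 i, fun l => (he _).2 l⟩⟩

theorem mem_globalHypotheses_predict (D : Dynamics d) (B : Birth d nb) {T : Fin n → Track d k}
    {m : ℕ → ℕ} {k' : ℕ} {a : (i : Fin n) → Fin (T i).h}
    {a' : (i : Fin (n + nb)) → Fin (predict D B T i).h}
    (h1 : ∀ i, (predict D B T (Fin.castAdd nb i)).M (a' (Fin.castAdd nb i)) = (T i).M (a i))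
    (h2 : ∀ l, (predict D B T (Fin.natAdd n l)).M (a' (Fin.natAdd n l)) = ∅) :
    a' ∈ globalHypotheses m k' (predict D B T) ↔ a ∈ globalHypotheses m k' T := by
  have f : ∀ P : Fin (n + nb) → Prop,
      (∀ i, P i) ↔ (∀ i, P (Fin.castAdd nb i)) ∧ ∀ l, P (Fin.natAdd n l) := fun P =>
    ⟨fun h => ⟨fun i => h _, fun l => h _⟩, fun h i => Fin.addCases h.1 h.2 i⟩
  classical
  rw [globalHypotheses, globalHypotheses, Finset.mem_filter, Finset.mem_filter]
  simp only [Finset.mem_univ, true_and, Set.iUnion_subset_iff, Pairwise]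
  refine and_congr ?_ ?_
  · rw [f]
    simp only [h1, h2, Finset.coe_empty, Set.empty_subset, implies_true, and_true]
  · rw [f]
    simp only [f (fun j => _ ≠ j → _), h1, h2, Finset.disjoint_empty_left,
      Finset.disjoint_empty_right, implies_true, and_true]
    simp [(Fin.castAdd_injective n nb).eq_iff]

theorem isMBM_predict (D : Dynamics d) (B : Birth d nb) {T : Fin n → Track d k}
    {m : ℕ → ℕ} {k' : ℕ} (hT : IsMBM m k' T) (htot : totalWeight m k' (predict D B T) ≠ 0) :
    IsMBM m k' (predict D B T) := by
  let P : Track d (k + 1) → Prop := fun t => ∀ a, t.w a ≠ ∞ ∧ t.r a ≤ 1 ∧ Measurable (t.f a) ∧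
    ∫⁻ X, t.f a X ∂trajMeasure d (k + 1) = 1
  have hP : ∀ i, P (predict D B T i) := by
    intro i
    refine Fin.addCases (fun i => ?_) (fun l => ?_) i
    · rw [predict, Fin.append_left]
      exact fun a => ⟨hT.w_ne_top i a, hT.r_le_one i a,
        D.measurable_innerTransition (hT.measurable_f i a),
        D.lintegral_innerTransition (hT.measurable_f i a) (hT.lintegral_f i a)⟩
    · rw [predict, Fin.append_right]
      exact fun a => ⟨ENNReal.one_ne_top, B.r_le_one l, measurable_birthDensity (B.measurable_f l),
        lintegral_birthDensity (B.measurable_f l) (B.lintegral_f l)⟩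
  exact ⟨fun i a => (hP i a).1, htot, fun i a => (hP i a).2.1, fun i a => (hP i a).2.2.1,
    fun i a => (hP i a).2.2.2⟩

/-- The predicted parameters are those of an MBM, and the MBM law with these parameters is the
mixture, with the prior weights, of the predicted multi-Bernoulli laws. -/
theorem isMBM_predict_and_mbmLaw_eq (hd : 0 < d) (D : Dynamics d) (B : Birth d nb)
    {T : Fin n → Track d k} {m : ℕ → ℕ} {k' : ℕ} (hT : IsMBM m k' T) :
    IsMBM m k' (predict D B T) ∧ mbmLaw m k' (predict D B T) =
      ∑ a ∈ globalHypotheses m k' T, globalWeight m k' T a •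
        indepUnion (Sum.elim (fun l => birthLaw (k + 1) (B.r l) (B.f l))
          fun i => bernoulliLaw ((T i).r (a i))
            ((trajMeasure d (k + 1)).withDensity (D.innerTransition ((T i).f (a i))))) := by
  obtain ⟨e, he⟩ := exists_equiv_predict D B T
  simp only [Track.params, Prod.mk.injEq] at he
  have hmem : ∀ a, e a ∈ globalHypotheses m k' (predict D B T) ↔ a ∈ globalHypotheses m k' T :=
    fun a => mem_globalHypotheses_predict D B (fun i => ((he a).1 i).1) fun l => ((he a).2 l).1
  have hw : ∀ a, ∏ i, (predict D B T i).w (e a i) = ∏ i, (T i).w (a i) := by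
    intro a
    rw [Fin.prod_univ_add, Finset.prod_congr rfl fun i _ => ((he a).1 i).2.1,
      Finset.prod_congr rfl fun l _ => ((he a).2 l).2.1, Finset.prod_const_one, mul_one]
  have htot : totalWeight m k' (predict D B T) = totalWeight m k' T :=
    (Finset.sum_equiv e (fun a => (hmem a).symm) fun a _ => (hw a).symm).symm
  have hmbm := isMBM_predict D B hT (htot ▸ hT.totalWeight_ne_zero)
  refine ⟨hmbm, ?_⟩
  rw [mbmLaw_eq_sum hd hmbm]
  refine (Finset.sum_equiv e (fun a => (hmem a).symm) fun a _ => ?_).symm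
  have hprob : ∀ i, IsProbabilityMeasure (bernoulliLaw ((predict D B T i).r (e a i))
      ((trajMeasure d (k + 1)).withDensity ((predict D B T i).f (e a i)))) := fun i => by
    have := isProbabilityMeasure_withDensity (hmbm.lintegral_f i (e a i))
    exact isProbabilityMeasure_bernoulliLaw (hmbm.r_le_one i _) _
  have hinj : Function.Injective (Sum.elim (Fin.natAdd n) (Fin.castAdd nb)) := by
    rintro (l | i) (l' | i') h <;> simp only [Sum.elim_inl, Sum.elim_inr, Fin.ext_iff,
      Fin.val_natAdd, Fin.val_castAdd] at h
    · exact congrArg Sum.inl (Fin.ext (by omega))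
    · omega
    · omega
    · exact congrArg Sum.inr (Fin.ext h)
  rw [globalWeight, globalWeight, hw, htot]
  congr 1
  refine (indepUnion_eq_of_injective hinj ?_ ?_).symm
  · rintro (l | i)
    · simp only [Sum.elim_inl, ((he a).2 l).2.2.1, ((he a).2 l).2.2.2]
      exact birthLaw_eq_bernoulliLaw hd (B.r_le_one l) (B.measurable_f l) (B.lintegral_f l)
    · simp only [Sum.elim_inr, ((he a).1 i).2.2.1, ((he a).1 i).2.2.2]
  · intro i hi
    refine absurd ?_ hi
    exact Fin.addCases (fun i => ⟨Sum.inr i, rfl⟩) (fun l => ⟨Sum.inl l, rfl⟩) i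

end Mixture

end TrajMBM

/-- Prediction step for the trajectory MBM filter on the set of all trajectories, from time `k` to
time `k + 1`; `m τ` is the number of measurements at time `τ`, and all the measurements up to time
`k` have been processed. The predicted parameters are again those of an MBM; the densities of the
continuing tracks are `⟨f; π^a⟩`, i.e. densities of `∫ f(X') π^a(· | X') dX'`; and the predicted
law `∫ f(· | S') f_{k|k}(S') δS'` has the MBM density with the predicted parameters. -/
theorem theorem2 {d : ℕ} (hd : 0 < d) (k : ℕ) (m : ℕ → ℕ) {n nb : ℕ}
    (D : TrajMBM.Dynamics d) (B : TrajMBM.Birth d nb)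
    (prior : Fin n → TrajMBM.Track d k) (hprior : TrajMBM.IsMBM m k prior) :
    TrajMBM.IsMBM m k (TrajMBM.predict D B prior) ∧
    Measurable (D.trajTransition (k := k)) ∧
    (∀ i a,
      ((TrajMBM.trajMeasure d k).withDensity ((prior i).f a)).bind D.trajTransition =
        (TrajMBM.trajMeasure d (k + 1)).withDensity (D.innerTransition ((prior i).f a))) ∧
    AEMeasurable (D.setTransition B k) (TrajMBM.mbmLaw m k prior) ∧
    (TrajMBM.mbmLaw m k prior).bind (D.setTransition B k) =
      TrajMBM.mbmLaw m k (TrajMBM.predict D B prior) := by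
  obtain ⟨hmbm, hlaw⟩ := TrajMBM.isMBM_predict_and_mbmLaw_eq hd D B hprior
  have hm := TrajMBM.measurable_setTransition (k := k) D B hd
  have hbind := fun i a => D.withDensity_bind_trajTransition (hprior.measurable_f i a)
  refine ⟨hmbm, D.measurable_trajTransition, hbind, hm.aemeasurable, ?_⟩
  rw [hlaw, TrajMBM.mbmLaw_eq_sum hd hprior, TrajMBM.sum_smul_bind _ _ _ hm]
  refine Finset.sum_congr rfl fun a _ => ?_
  have := TrajMBM.nullSingletonClass_trajMeasure (k := k) hd
  have := fun i => TrajMBM.isProbabilityMeasure_withDensity (hprior.lintegral_f i (a i))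
  rw [TrajMBM.indepUnion_bernoulli_bind_setTransition D B hd fun i => hprior.r_le_one i (a i)]
  simp_rw [hbind]
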